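/- For nonzero complex numbers $x,q$, a complex number $p$ with $|p|<1$, and an integer $k\ge 0$, let $$\theta(x;p)=\prod_{i=0}^{\infty}(1-xp^i)(1-p^{i+1}/x),\qquad (x;q,p)_k=\prod_{i=0}^{k-1}\theta(xq^i;p),$$ and $(x_1,\dots,x_r;q,p)_k=(x_1;q,p)_k\cdots(x_r;q,p)_k$. Let $n$ be a non-negative integer and let $a,b,q$ be nonzero complex numbers and $p$ a complex number with $|p|<1$, such that none of the denominators appearing in the following identity vanishes. Then $$\sum_{j=0}^{n}\frac{\theta(a^2b^2q^{8j+2};p^4)\,(b^2q^{2n},q^{-2n};q^2,p^2)_j\,(a^2b^2q^2,b/aq;q^4,p^4)_j\,(-aq;q,p)_{2j}}{\theta(a^2b^2q^2;p^4)\,(aq^{3-2n}/b,abq^{3+2n};q^2,p^2)_j\,(q^4,a^3bq^7;q^4,p^4)_j\,(-bq;q,p)_{2j}}\Big(\frac{aq^4}{b}\Big)^j$$ $$=\frac{\theta(-b;p)\,(-q,b/a;q,p)_n\,(abq^3;q^2,p^2)_n}{\theta(-bq^{2n};p)\,(-b,aq;q,p)_n\,(b/aq;q^2,p^2)_n}\,q^{-n}\sum_{k=0}^{n}\frac{\theta(a^4q^{8k};p^4)\,(bq^n,q^{-n};q,p)_k\,(a^4,a/bq^3;q^4,p^4)_k}{\theta(a^4;p^4)\,(aq^{1-n}/b,aq^{1+n};q,p)_k\,(q^4,a^3bq^7;q^4,p^4)_k}\,q^{4k}.$$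 Here $b/aq$ means $b/(aq)$ and $a/bq^3$ means $a/(bq^3)$. -/

import Mathlib

noncomputable section

/-- The infinite `p`-shifted factorial `(a; p)_∞ = ∏_{j ≥ 0} (1 - a p^j)`, used for `|p| < 1`
(where the product converges). -/
def qShiftedInf (a p : ℂ) : ℂ := ∏' j : ℕ, (1 - a * p ^ j)

/-- The modified Jacobi theta function `θ(a; p) = (a; p)_∞ (p/a; p)_∞`, for `a ≠ 0`, `|p| < 1`. -/
def ellTheta (a p : ℂ) : ℂ := qShiftedInf a p * qShiftedInf (p / a) p

/-- The theta shifted factorial `(a; q, p)_k = ∏_{j = 0}^{k-1} θ(a q^j; p)`. -/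
def ellFac (a q p : ℂ) (k : ℕ) : ℂ := ∏ j ∈ Finset.range k, ellTheta (a * q ^ j) p

end

/-!
The proof is an application of the well-poised Bailey transform. For a base `q` and nome `p` let
`M(A, K; q)` be the infinite lower triangular matrix `wpMat` with entries
`(K/A)_{n-k} (K)_{n+k} / ((q)_{n-k} (Aq)_{n+k})`, all factorials being theta shifted factorials.
Up to a factor depending on `n` only, its `n`-th row consists of the coefficients
`(K q^n, q^{-n})_k / (A q^{1-n} / K, A q^{n+1})_k (A q / K)^k` of a terminating well-poised series.

Everything rests on Weierstrass' three-term relation for theta functions, `ellTheta_addition`. It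
comes from the triple product identity: splitting a product of two theta series by parity shows that
`y θ(xy) θ(x/y)` is a `2 × 2` minor, and the relation is the Plücker relation for such minors. From
it the Frenkel–Turaev summation `sum_wpMat_mul_wpTerm` follows by induction on the length of the
sum, and a special case of the latter says that the inverse of `M(A, K; q)` is again a well-poised
matrix, up to diagonal factors (`sum_wpMat_mul_wpInv`).

The quadratic step uses the Frenkel–Turaev sum with `K` a square root of `a b q`. Since
`θ(x²; p²) = θ(x; p) θ(-x; p)`, it expresses `M(a², abq; q²)`, with nome `p²`, through the product
of `M(b², abq; q²)` and `M(a, b; q)`, with diagonal matrices in between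
(`QuadGeneric.sum_quadratic`). Inverting the matrix `M(b², abq; q²)` gives
`M(abq, b²; q²) D M(a², abq; q²) = D' M(a, b; q)` with diagonal `D` and `D'`
(`QuadGeneric.sum_connection`). Both sides are applied to the first column of the inverse of
`M(a⁴, a³bq³; q⁴)`. On the right this is the series with base `q`. On the left the product
of that column with `M(a², abq; q²)` is evaluated by a quadratic summation
(`QuadGeneric.sum_wpMat_mul_wpInv_sq`), itself the connection formula followed by an inversion, for
the parameters `a²`, `abq` and base `q²`; what remains is the series with base `q²`.

The argument divides by many theta functions besides the denominators of the identity. It is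
carried out for parameters whose absolute values are multiplicatively independent modulo powers of
`‖p‖`. Such parameters are dense (`frequently_mulIndep`), and both sides of the identity are
continuous wherever their denominators do not vanish.
-/

open Filter Topology Finset

/-! ### The theta function -/

lemma summable_norm_mul_pow {p : ℂ} (hp : ‖p‖ < 1) (a : ℂ) :
    Summable fun j : ℕ => ‖-(a * p ^ j)‖ := by
  simp only [norm_neg, norm_mul, norm_pow]
  exact (summable_geometric_of_lt_one (norm_nonneg _) hp).mul_left _

lemma multipliable_one_sub_mul_pow {p : ℂ} (hp : ‖p‖ < 1) (a : ℂ) :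
    Multipliable fun j : ℕ => 1 - a * p ^ j := by
  simpa [sub_eq_add_neg] using multipliable_one_add_of_summable (summable_norm_mul_pow hp a)

lemma qShiftedInf_eq_mul {p : ℂ} (hp : ‖p‖ < 1) (a : ℂ) :
    qShiftedInf a p = (1 - a) * qShiftedInf (a * p) p := by
  unfold qShiftedInf
  rw [tprod_eq_zero_mul']
  · congr 1
    · simp
    · exact tprod_congr fun j => by ring
  · convert multipliable_one_sub_mul_pow hp (a * p) using 2 with j
    ring

lemma qShiftedInf_sq {p : ℂ} (hp : ‖p‖ < 1) (a : ℂ) :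
    qShiftedInf (a ^ 2) (p ^ 2) = qShiftedInf a p * qShiftedInf (-a) p := by
  unfold qShiftedInf
  rw [← (multipliable_one_sub_mul_pow hp a).tprod_mul (multipliable_one_sub_mul_pow hp (-a))]
  exact tprod_congr fun j => by ring

lemma qShiftedInf_ne_zero {p : ℂ} (hp : ‖p‖ < 1) {a : ℂ} (h : ∀ j : ℕ, a * p ^ j ≠ 1) :
    qShiftedInf a p ≠ 0 := by
  have := tprod_one_add_ne_zero_of_summable (f := fun j : ℕ => -(a * p ^ j))
    (fun j hj => h j (by linear_combination -hj)) (summable_norm_mul_pow hp a)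
  simpa [qShiftedInf, sub_eq_add_neg] using this

lemma continuous_qShiftedInf {p : ℂ} (hp : ‖p‖ < 1) : Continuous fun a => qShiftedInf a p := by
  rw [continuous_iff_continuousAt]
  intro a
  have hs : Summable fun j : ℕ => (‖a‖ + 1) * ‖p‖ ^ j :=
    (summable_geometric_of_lt_one (norm_nonneg _) hp).mul_left _
  have h := hs.hasProdLocallyUniformlyOn_one_add (f := fun (j : ℕ) (x : ℂ) => -(x * p ^ j))
    (K := Metric.ball 0 (‖a‖ + 1)) Metric.isOpen_ball
    (Eventually.of_forall fun j x hx => by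
      have hx' : ‖x‖ < ‖a‖ + 1 := by simpa using hx
      rw [norm_neg, norm_mul, norm_pow]
      gcongr)
    (fun j => by fun_prop)
  have hc : ContinuousOn (fun x => ∏' j : ℕ, (1 + -(x * p ^ j))) (Metric.ball 0 (‖a‖ + 1)) :=
    (hasProdLocallyUniformlyOn_iff_tendstoLocallyUniformlyOn.mp h).continuousOn
      (Eventually.of_forall fun s => by
        apply Continuous.continuousOn
        fun_prop).frequently
  have hc' := hc.continuousAt (Metric.isOpen_ball.mem_nhds
    (show a ∈ Metric.ball 0 (‖a‖ + 1) by simp))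
  simpa [qShiftedInf, sub_eq_add_neg] using hc'

lemma continuousAt_ellTheta {p : ℂ} (hp : ‖p‖ < 1) {a : ℂ} (ha : a ≠ 0) :
    ContinuousAt (fun a => ellTheta a p) a := by
  unfold ellTheta
  exact ((continuous_qShiftedInf hp).continuousAt).mul
    ((continuous_qShiftedInf hp).continuousAt.comp (f := fun a => p / a)
      (by fun_prop (disch := exact ha)))

/-- The zeros of `θ(·; p)` lie on the circles of radius `‖p‖ ^ m`, `m ∈ ℤ`; the two conditions are
those for nonnegative and for nonpositive `m`, which remain meaningful for `p = 0`. -/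
lemma ellTheta_ne_zero {p : ℂ} (hp : ‖p‖ < 1) {a : ℂ} (ha : a ≠ 0)
    (h : ∀ m : ℕ, ‖a‖ ≠ ‖p‖ ^ m ∧ ‖a‖ * ‖p‖ ^ m ≠ 1) : ellTheta a p ≠ 0 := by
  refine mul_ne_zero (qShiftedInf_ne_zero hp fun j hj => (h j).2 ?_)
    (qShiftedInf_ne_zero hp fun j hj => (h (j + 1)).1 ?_)
  · rw [← norm_pow, ← norm_mul, hj, norm_one]
  · rw [← norm_pow, show a = p ^ (j + 1) by field_simp at hj; rw [← hj]; ring]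

lemma ellTheta_one {p : ℂ} (hp : ‖p‖ < 1) : ellTheta 1 p = 0 := by
  rw [ellTheta, qShiftedInf_eq_mul hp]
  simp

lemma ellTheta_inv {p : ℂ} (hp : ‖p‖ < 1) {x : ℂ} (hx : x ≠ 0) :
    ellTheta x⁻¹ p = -x⁻¹ * ellTheta x p := by
  rw [ellTheta, ellTheta, qShiftedInf_eq_mul hp x⁻¹, qShiftedInf_eq_mul hp x,
    show p / x⁻¹ = x * p by field_simp, show p / x = x⁻¹ * p by field_simp]
  field_simp
  ring

lemma ellTheta_sq {p : ℂ} (hp : ‖p‖ < 1) (x : ℂ) :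
    ellTheta (x ^ 2) (p ^ 2) = ellTheta x p * ellTheta (-x) p := by
  rw [ellTheta, ellTheta, ellTheta, ← div_pow, qShiftedInf_sq hp, qShiftedInf_sq hp, div_neg]
  ring

/-! ### The triple product and the addition formula -/

/-- The triangular number `k (k - 1) / 2` of an integer `k`. -/
def tri (k : ℤ) : ℤ := k * (k - 1) / 2

lemma two_mul_tri (k : ℤ) : 2 * tri k = k * (k - 1) :=
  Int.mul_ediv_cancel' (Int.even_mul_pred_self k).two_dvd

lemma tri_add_one (k : ℤ) : tri (k + 1) = tri k + k := by
  have h1 := two_mul_tri k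
  have h2 := two_mul_tri (k + 1)
  have : 2 * tri (k + 1) = 2 * (tri k + k) := by rw [h2, mul_add, h1]; ring
  omega

/-- The reciprocal of the finite product `(1 - p) ⋯ (1 - p ^ m)`, extended by `0` to negative `m`,
so that `recipFac_sub_one` holds for all integers. -/
noncomputable def recipFac (p : ℂ) (m : ℤ) : ℂ :=
  if m < 0 then 0 else (∏ i ∈ range m.toNat, (1 - p ^ (i + 1)))⁻¹

lemma one_sub_pow_succ_ne_zero {p : ℂ} (hp : ‖p‖ < 1) (i : ℕ) : 1 - p ^ (i + 1) ≠ 0 := by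
  intro h
  have h1 : ‖p ^ (i + 1)‖ = 1 := by rw [← sub_eq_zero.mp h, norm_one]
  rw [norm_pow] at h1
  exact absurd h1 (pow_lt_one₀ (norm_nonneg _) hp (by omega)).ne

lemma recipFac_sub_one {p : ℂ} (hp : ‖p‖ < 1) (m : ℤ) :
    recipFac p (m - 1) = (1 - p ^ m) * recipFac p m := by
  rcases lt_trichotomy m 0 with h | rfl | h
  · simp [recipFac, h, show m - 1 < 0 by omega]
  · simp [recipFac]
  · obtain ⟨k, rfl⟩ : ∃ k : ℕ, m = k + 1 := ⟨(m - 1).toNat, by omega⟩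
    have h1 : ((k : ℤ) + 1).toNat = k + 1 := by omega
    have h2 := one_sub_pow_succ_ne_zero hp k
    have h3 : p ^ ((k : ℤ) + 1) = p ^ (k + 1) := by norm_cast
    simp only [recipFac, add_sub_cancel_right, h1, h3]
    rw [if_neg (by omega), if_neg (by omega), prod_range_succ, Int.toNat_natCast]
    field_simp

/-- The finite form of the triple product identity. -/
lemma hasSum_finite_tripleProduct {p : ℂ} (hp : ‖p‖ < 1) (hp0 : p ≠ 0) {x : ℂ} (hx : x ≠ 0)
    (N : ℕ) :
    HasSum (fun k : ℤ => (-1) ^ k * p ^ tri k * ((∏ i ∈ range (2 * N), (1 - p ^ (i + 1))) *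
      recipFac p (N - k) * recipFac p (N + k)) * x ^ k)
      (∏ i ∈ range N, ((1 - x * p ^ i) * (1 - p ^ (i + 1) / x))) := by
  induction N with
  | zero =>
    convert hasSum_ite_eq (0 : ℤ) (1 : ℂ) using 2 with k
    rcases lt_trichotomy k 0 with h | rfl | h
    · simp [recipFac, h, h.ne]
    · simp [recipFac, tri]
    · simp [recipFac, h, h.ne']
    · simp
  | succ N ih =>
    -- Multiplying by the factors for `i = N` turns the coefficient of `x ^ k` into a combination of
    -- the coefficients with indices `k`, `k - 1` and `k + 1`.
    set c : ℤ → ℂ := fun k : ℤ => (-1) ^ k * p ^ tri k *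
      ((∏ i ∈ range (2 * N), (1 - p ^ (i + 1))) *
      recipFac p (N - k) * recipFac p (N + k)) * x ^ k with hc
    set P := ∏ i ∈ range N, ((1 - x * p ^ i) * (1 - p ^ (i + 1) / x)) with hP
    have h1 : HasSum (fun k : ℤ => c (k - 1)) P :=
      (Equiv.hasSum_iff (f := c) (a := P) (Equiv.subRight (1 : ℤ))).mpr ih
    have h2 : HasSum (fun k : ℤ => c (k + 1)) P :=
      (Equiv.hasSum_iff (f := c) (a := P) (Equiv.addRight (1 : ℤ))).mpr ih
    have h3 := ((ih.mul_left (1 + p ^ (2 * N + 1))).sub (h1.mul_left (x * p ^ N))).sub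
      (h2.mul_left (p ^ (N + 1) / x))
    have hval : ∏ i ∈ range (N + 1), ((1 - x * p ^ i) * (1 - p ^ (i + 1) / x)) =
        (1 + p ^ (2 * N + 1)) * P - x * p ^ N * P - p ^ (N + 1) / x * P := by
      rw [prod_range_succ, ← hP]
      field_simp
      ring
    rw [hval]
    refine h3.congr_fun fun k => ?_
    have e1 := recipFac_sub_one hp ((N + 1 : ℕ) - k)
    have e2 := recipFac_sub_one hp ((N + 1 : ℕ) + k)
    have e3 := recipFac_sub_one hp ((N + 1 : ℕ) - k - 1)
    have e4 := recipFac_sub_one hp ((N + 1 : ℕ) + k - 1)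
    rw [show ((N + 1 : ℕ) : ℤ) - k - 1 = N - k by push_cast; ring] at e1 e3
    rw [show ((N + 1 : ℕ) : ℤ) + k - 1 = N + k by push_cast; ring] at e2 e4
    have t1 : tri (k + 1) = tri k + k := tri_add_one k
    have t2 : tri (k - 1) = tri k - (k - 1) := by
      have := tri_add_one (k - 1)
      rw [sub_add_cancel] at this
      omega
    simp only [hc]
    rw [show (N : ℤ) - (k - 1) = (N + 1 : ℕ) - k by push_cast; ring,
      show (N : ℤ) + (k - 1) = N + k - 1 by ring,
      show (N : ℤ) - (k + 1) = N - k - 1 by ring,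
      show (N : ℤ) + (k + 1) = (N + 1 : ℕ) + k by push_cast; ring,
      e4, e3, e2, e1, t1, t2, show 2 * (N + 1) = 2 * N + 1 + 1 by ring,
      prod_range_succ, prod_range_succ]
    have n1 : (-1 : ℂ) ≠ 0 := by norm_num
    generalize recipFac p ((N + 1 : ℕ) - k) = A
    generalize recipFac p ((N + 1 : ℕ) + k) = B
    generalize ∏ i ∈ range (2 * N), (1 - p ^ (i + 1)) = C
    rw [show tri k - (k - 1) = tri k - k + 1 by ring]
    push_cast
    simp only [zpow_add₀ hp0, zpow_sub₀ hp0, zpow_add₀ hx, zpow_sub₀ hx, zpow_add₀ n1,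
      zpow_sub₀ n1, zpow_one, zpow_natCast]
    generalize hD : p ^ tri k = D
    generalize ((-1 : ℂ) ^ k) = E
    have hpk : p ^ k ≠ 0 := zpow_ne_zero k hp0
    generalize p ^ k = F at hpk ⊢
    generalize x ^ k = G
    rw [show p ^ (2 * N + 1 + 1) = (p ^ N) ^ 2 * p ^ 2 by ring,
      show p ^ (2 * N + 1) = (p ^ N) ^ 2 * p by ring]
    rw [show p ^ (N + 1) = p ^ N * p by ring]
    generalize p ^ N = H
    field_simp
    ring

lemma summable_pow_tri_nat {r y : ℝ} (hr : 0 < r) (hr1 : r < 1) (hy : 0 < y) :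
    Summable fun k : ℕ => r ^ tri k * y ^ k := by
  have hpos : ∀ k : ℕ, 0 < r ^ tri k * y ^ k := fun k => by positivity
  refine summable_of_ratio_test_tendsto_lt_one (l := 0) one_pos
    (Eventually.of_forall fun k => (hpos k).ne') ?_
  have : Tendsto (fun k : ℕ => r ^ k * y) atTop (𝓝 (0 * y)) :=
    (tendsto_pow_atTop_nhds_zero_of_lt_one hr.le hr1).mul_const y
  rw [zero_mul] at this
  refine this.congr fun k => ?_
  rw [Real.norm_of_nonneg (hpos _).le, Real.norm_of_nonneg (hpos _).le, eq_div_iff (hpos k).ne',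
    Nat.cast_add, Nat.cast_one, tri_add_one, zpow_add₀ hr.ne', zpow_natCast]
  ring

lemma summable_pow_tri {r y : ℝ} (hr : 0 < r) (hr1 : r < 1) (hy : 0 < y) :
    Summable fun k : ℤ => r ^ tri k * y ^ k := by
  refine Summable.of_nat_of_neg ?_ ?_
  · simpa using summable_pow_tri_nat hr hr1 hy
  · refine (summable_pow_tri_nat hr hr1 (show 0 < r / y by positivity)).congr fun k => ?_
    have h : tri (-k) = tri k + k := by
      have h1 := two_mul_tri k
      have h2 := two_mul_tri (-k)
      have : 2 * tri (-k) = 2 * (tri k + k) := by rw [h2, mul_add, h1]; ring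
      omega
    rw [h, zpow_add₀ hr.ne', zpow_natCast, zpow_neg, zpow_natCast, div_pow]
    ring

/-- The theta series `∑ p ^ (k (k - 1) / 2) z ^ k` over all integers `k`. -/
noncomputable def thetaSeries (p z : ℂ) : ℂ := ∑' k : ℤ, p ^ tri k * z ^ k

lemma summable_norm_thetaSeries {p z : ℂ} (hp : ‖p‖ < 1) (hp0 : p ≠ 0) (hz : z ≠ 0) :
    Summable fun k : ℤ => ‖p ^ tri k * z ^ k‖ := by
  simp only [norm_mul, norm_zpow]
  exact summable_pow_tri (norm_pos_iff.mpr hp0) hp (norm_pos_iff.mpr hz)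

lemma thetaSeries_mul {p z : ℂ} (hp0 : p ≠ 0) (hz : z ≠ 0) :
    thetaSeries p (p * z) = z⁻¹ * thetaSeries p z := by
  unfold thetaSeries
  rw [← tsum_mul_left, ← (Equiv.addRight (1 : ℤ)).tsum_eq (fun k : ℤ => z⁻¹ * (p ^ tri k * z ^ k))]
  refine tsum_congr fun k => ?_
  simp only [Equiv.coe_addRight, tri_add_one, zpow_add₀ hp0, zpow_add₀ hz, mul_zpow, zpow_one]
  field_simp

/-- The triple product identity up to the constant, which plays no role in three-term relations:
the limit of its finite form, by dominated convergence. -/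
lemma ellTheta_eq_thetaSeries {p : ℂ} (hp : ‖p‖ < 1) (hp0 : p ≠ 0) :
    ∃ κ : ℂ, ∀ x : ℂ, x ≠ 0 → ellTheta x p = κ * thetaSeries p (-x) := by
  set Q : ℕ → ℂ := fun n => ∏ i ∈ range n, (1 - p ^ (i + 1)) with hQ
  have hm : Multipliable fun i : ℕ => 1 - p ^ (i + 1) := by
    convert multipliable_one_sub_mul_pow hp p using 2 with i
    ring
  obtain ⟨q, hq0, hlim⟩ : ∃ q : ℂ, q ≠ 0 ∧ Tendsto Q atTop (𝓝 q) := by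
    refine ⟨_, ?_, hm.hasProd.tendsto_prod_nat⟩
    have := qShiftedInf_ne_zero hp (a := p) fun j hj => one_sub_pow_succ_ne_zero hp j (by
      rw [pow_succ', hj, sub_self])
    simpa only [qShiftedInf, ← pow_succ'] using this
  have hrlim : Tendsto (fun m : ℤ => recipFac p m) atTop (𝓝 q⁻¹) := by
    have h1 : Tendsto (fun m : ℤ => (Q m.toNat)⁻¹) atTop (𝓝 q⁻¹) :=
      (hlim.comp (tendsto_atTop_atTop.mpr fun n : ℕ =>
        ⟨(n : ℤ), fun m hm => by omega⟩ : Tendsto Int.toNat atTop atTop)).inv₀ hq0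
    refine h1.congr' ?_
    filter_upwards [eventually_ge_atTop 0] with m hm
    simp [recipFac, hQ, not_lt.mpr hm]
  obtain ⟨C, hC⟩ := (Metric.isBounded_range_of_tendsto _ hlim).exists_norm_le
  obtain ⟨D, hD⟩ := (Metric.isBounded_range_of_tendsto _ (hlim.inv₀ hq0)).exists_norm_le
  have hC0 : 0 ≤ C := (norm_nonneg _).trans (hC (Q 0) ⟨0, rfl⟩)
  have hD0 : 0 ≤ D := (norm_nonneg _).trans (hD (Q 0)⁻¹ ⟨0, rfl⟩)
  have hrD : ∀ m : ℤ, ‖recipFac p m‖ ≤ D := fun m => by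
    unfold recipFac
    split_ifs
    · simpa using hD0
    · exact hD _ ⟨m.toNat, rfl⟩
  refine ⟨q * q⁻¹ * q⁻¹, fun x hx => ?_⟩
  have hprod : Tendsto (fun N => ∏ i ∈ range N, ((1 - x * p ^ i) * (1 - p ^ (i + 1) / x))) atTop
      (𝓝 (ellTheta x p)) := by
    have h := ((multipliable_one_sub_mul_pow hp x).hasProd.mul
      (multipliable_one_sub_mul_pow hp (p / x)).hasProd).tendsto_prod_nat
    refine h.congr fun N => prod_congr rfl fun i _ => ?_
    rw [pow_succ]
    ring
  refine tendsto_nhds_unique hprod ?_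
  have hsum := fun N => (hasSum_finite_tripleProduct hp hp0 hx N).tsum_eq
  simp only [← hsum]
  unfold thetaSeries
  rw [← tsum_mul_left]
  refine tendsto_tsum_of_dominated_convergence
    (bound := fun k : ℤ => (C * D * D) * (‖p‖ ^ tri k * ‖x‖ ^ k))
    ((summable_pow_tri (norm_pos_iff.mpr hp0) hp (norm_pos_iff.mpr hx)).mul_left _) ?_ ?_
  · intro k
    have h1 : Tendsto (fun N : ℕ => Q (2 * N)) atTop (𝓝 q) :=
      hlim.comp (tendsto_atTop_atTop.mpr fun n => ⟨n, fun m hm => by omega⟩)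
    have h2 : Tendsto (fun N : ℕ => recipFac p (N - k)) atTop (𝓝 q⁻¹) :=
      hrlim.comp (tendsto_atTop_atTop.mpr fun n => ⟨(n + k).toNat, fun m hm => by omega⟩)
    have h3 : Tendsto (fun N : ℕ => recipFac p (N + k)) atTop (𝓝 q⁻¹) :=
      hrlim.comp (tendsto_atTop_atTop.mpr fun n => ⟨(n - k).toNat, fun m hm => by omega⟩)
    have h4 := (((h1.mul h2).mul h3).const_mul ((-1) ^ k * p ^ tri k)).mul_const (x ^ k)
    convert h4 using 2
    rw [neg_eq_neg_one_mul x, mul_zpow]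
    ring
  · refine Eventually.of_forall fun N k => ?_
    have h1 := hC _ ⟨2 * N, rfl⟩
    have h2 := hrD (N - k)
    have h3 := hrD (N + k)
    have h4 : ‖Q (2 * N)‖ * ‖recipFac p (N - k)‖ * ‖recipFac p (N + k)‖ ≤ C * D * D := by gcongr
    calc _ = ‖Q (2 * N)‖ * ‖recipFac p (N - k)‖ * ‖recipFac p (N + k)‖ *
          (‖p‖ ^ tri k * ‖x‖ ^ k) := by
          simp only [hQ, norm_mul, norm_zpow, norm_neg, norm_one, one_zpow, one_mul]
          ring
      _ ≤ _ := by gcongr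

/-- Integers of equal or of different parity: every pair `(m, n)` is `(i + j, i - j)` or
`(i + j + 1, i - j)`, in exactly one way. -/
def parityEquiv : (ℤ × ℤ) ⊕ (ℤ × ℤ) ≃ ℤ × ℤ where
  toFun := Sum.elim (fun z => (z.1 + z.2, z.1 - z.2)) (fun z => (z.1 + z.2 + 1, z.1 - z.2))
  invFun z := if (z.1 + z.2) % 2 = 0 then .inl ((z.1 + z.2) / 2, (z.1 - z.2) / 2)
    else .inr ((z.1 + z.2) / 2, (z.1 - z.2) / 2)
  left_inv := by
    rintro (⟨i, j⟩ | ⟨i, j⟩)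
    · change (if (i + j + (i - j)) % 2 = 0 then _ else _) = _
      rw [if_pos (by omega)]
      simp only [Sum.inl.injEq, Prod.mk.injEq, Sum.elim_inl]
      omega
    · change (if (i + j + 1 + (i - j)) % 2 = 0 then _ else _) = _
      rw [if_neg (by omega)]
      simp only [Sum.inr.injEq, Prod.mk.injEq, Sum.elim_inr]
      omega
  right_inv := by
    rintro ⟨m, n⟩
    simp only
    split_ifs with h
    · simp only [Sum.elim_inl, Prod.mk.injEq]
      omega
    · simp only [Sum.elim_inr, Prod.mk.injEq]
      omega

/-- Splitting the double series according to the parity of the sum of the exponents separates the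
variables `x` and `y`. -/
lemma thetaSeries_mul_thetaSeries {p x y : ℂ} (hp : ‖p‖ < 1) (hp0 : p ≠ 0) (hx : x ≠ 0)
    (hy : y ≠ 0) :
    thetaSeries p (-(x * y)) * thetaSeries p (-(x / y)) =
      thetaSeries (p ^ 2) (x ^ 2) * thetaSeries (p ^ 2) (p * y ^ 2) -
        x * y * (thetaSeries (p ^ 2) (p * x ^ 2) * thetaSeries (p ^ 2) (p ^ 2 * y ^ 2)) := by
  have hp2 : ‖p ^ 2‖ < 1 := by rw [norm_pow]; exact pow_lt_one₀ (norm_nonneg _) hp (by norm_num)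
  have hp20 : p ^ 2 ≠ 0 := pow_ne_zero _ hp0
  have hs1 := summable_norm_thetaSeries hp hp0 (neg_ne_zero.mpr (mul_ne_zero hx hy))
  have hs2 := summable_norm_thetaSeries hp hp0 (neg_ne_zero.mpr (div_ne_zero hx hy))
  have hx2 : x ^ 2 ≠ 0 := pow_ne_zero _ hx
  have hy2 : y ^ 2 ≠ 0 := pow_ne_zero _ hy
  have hA := summable_norm_thetaSeries hp2 hp20 hx2
  have hB := summable_norm_thetaSeries hp2 hp20 (mul_ne_zero hp0 hy2)
  have hC := summable_norm_thetaSeries hp2 hp20 (mul_ne_zero hp0 hx2)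
  have hD := summable_norm_thetaSeries hp2 hp20 (mul_ne_zero hp20 hy2)
  have n1 : (-1 : ℂ) ≠ 0 := by norm_num
  unfold thetaSeries
  rw [tsum_mul_tsum_of_summable_norm hs1 hs2, tsum_mul_tsum_of_summable_norm hA hB,
    tsum_mul_tsum_of_summable_norm hC hD, ← parityEquiv.tsum_eq]
  have hsum := (parityEquiv.summable_iff).mpr (summable_mul_of_summable_norm hs1 hs2)
  have e1 : ∀ i j : ℤ, p ^ tri (i + j) * (-(x * y)) ^ (i + j) *
      (p ^ tri (i - j) * (-(x / y)) ^ (i - j)) =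
      ((p ^ 2) ^ tri i * (x ^ 2) ^ i) * ((p ^ 2) ^ tri j * (p * y ^ 2) ^ j) := by
    intro i j
    have ht : tri (i - j) = tri i + tri i + tri j + tri j + j - tri (i + j) := by
      have h1 := two_mul_tri i
      have h2 := two_mul_tri j
      have h3 := two_mul_tri (i + j)
      have h4 := two_mul_tri (i - j)
      linarith
    rw [ht, neg_eq_neg_one_mul (x * y), neg_eq_neg_one_mul (x / y)]
    simp only [zpow_add₀ hp0, zpow_sub₀ hp0, mul_zpow, div_zpow, zpow_add₀ hx, zpow_sub₀ hx,
      zpow_add₀ hy, zpow_sub₀ hy, zpow_add₀ n1, zpow_sub₀ n1, pow_two]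
    have m1 : ∀ k : ℤ, ((-1 : ℂ) ^ k) * (-1) ^ k = 1 := fun k => by rw [← mul_zpow]; simp
    have m2 := m1 i
    have m3 := zpow_ne_zero j n1
    field_simp
    linear_combination m2
  have e2 : ∀ i j : ℤ, p ^ tri (i + j + 1) * (-(x * y)) ^ (i + j + 1) *
      (p ^ tri (i - j) * (-(x / y)) ^ (i - j)) =
      -(x * y) * (((p ^ 2) ^ tri i * (p * x ^ 2) ^ i) *
        ((p ^ 2) ^ tri j * (p ^ 2 * y ^ 2) ^ j)) := by
    intro i j
    have h := e1 i j
    have hxy : -(x * y) ≠ 0 := neg_ne_zero.mpr (mul_ne_zero hx hy)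
    have hm : ((p ^ 2 * y ^ 2) ^ j : ℂ) = p ^ j * (p * y ^ 2) ^ j := by
      rw [← mul_zpow]
      ring_nf
    rw [tri_add_one, zpow_add₀ hp0, zpow_add₀ hxy, zpow_one, hm, mul_zpow p (x ^ 2), zpow_add₀ hp0]
    linear_combination (-(x * y) * p ^ i * p ^ j) * h
  refine (Summable.tsum_sum (hsum.comp_injective Sum.inl_injective)
    (hsum.comp_injective Sum.inr_injective)).trans ?_
  rw [sub_eq_add_neg, ← neg_mul (x * y), ← tsum_mul_left]
  congr 1
  · exact tsum_congr fun z => e1 z.1 z.2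
  · exact tsum_congr fun z => e2 z.1 z.2

lemma ellTheta_zero_right (x : ℂ) : ellTheta x 0 = 1 - x := by
  have h : qShiftedInf 0 0 = 1 := by simp [qShiftedInf]
  rw [ellTheta, qShiftedInf_eq_mul (by simp), mul_zero, zero_div, h]
  ring

/-- Weierstrass' three-term relation. By `thetaSeries_mul_thetaSeries`, `y θ(xy) θ(x/y)` is a
constant multiple of a `2 × 2` minor with one column depending on `x` and the other one on `y`;
the relation is the Plücker relation between the six minors. -/
lemma ellTheta_addition {p x y u v : ℂ} (hp : ‖p‖ < 1) (hx : x ≠ 0) (hy : y ≠ 0) (hu : u ≠ 0)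
    (hv : v ≠ 0) :
    ellTheta (x * y) p * ellTheta (x / y) p * ellTheta (u * v) p * ellTheta (u / v) p -
      ellTheta (x * v) p * ellTheta (x / v) p * ellTheta (u * y) p * ellTheta (u / y) p =
    u / y * (ellTheta (y * v) p * ellTheta (y / v) p * ellTheta (x * u) p *
      ellTheta (x / u) p) := by
  -- The theta series needs negative powers of `p`; for `p = 0` the relation is polynomial.
  by_cases hp0 : p = 0
  · subst hp0
    simp only [ellTheta_zero_right]
    field_simp
    ring
  obtain ⟨κ, hκ⟩ := ellTheta_eq_thetaSeries hp hp0
  set F : ℂ → ℂ := fun x => thetaSeries (p ^ 2) (x ^ 2) with hF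
  set G : ℂ → ℂ := fun x => x * thetaSeries (p ^ 2) (p * x ^ 2) with hG
  have key : ∀ {x y : ℂ}, x ≠ 0 → y ≠ 0 → ellTheta (x * y) p * ellTheta (x / y) p =
      κ ^ 2 / y * (F x * G y - G x * F y) := by
    intro x y hx hy
    rw [hκ _ (mul_ne_zero hx hy), hκ _ (div_ne_zero hx hy)]
    have h := thetaSeries_mul_thetaSeries hp hp0 hx hy
    rw [thetaSeries_mul (pow_ne_zero 2 hp0) (pow_ne_zero 2 hy)] at h
    simp only [hF, hG]
    rw [mul_mul_mul_comm, h]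
    field_simp
  rw [mul_assoc, mul_assoc (_ * ellTheta (x / v) p), mul_assoc (_ * ellTheta (y / v) p), key hx hy,
    key hu hv, key hx hv, key hu hy, key hy hv, key hx hu]
  field_simp
  ring

/-- The three-term relation for the products `θ(X t; p) θ(X / (a t); p)`, without the square root
of `a` that makes their arguments symmetric. -/
lemma ellTheta_addition_of_mul_eq {p a X Y Z t : ℂ} (hp : ‖p‖ < 1) (ha : a ≠ 0) (hX : X ≠ 0)
    (hY : Y ≠ 0) (hZ : Z ≠ 0) (ht : t ≠ 0) :
    ellTheta (X * t) p * ellTheta (X / (a * t)) p * ellTheta (Y * Z / a) p * ellTheta (Y / Z) p -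
      ellTheta (X * Z / a) p * ellTheta (X / Z) p * ellTheta (Y * t) p * ellTheta (Y / (a * t)) p =
    Y / (a * t) * (ellTheta (t * Z) p * ellTheta (a * t / Z) p * ellTheta (X * Y / a) p *
      ellTheta (X / Y) p) := by
  obtain ⟨s, rfl⟩ := IsAlgClosed.exists_pow_nat_eq a (n := 2) (by norm_num)
  have hs : s ≠ 0 := by rintro rfl; simp at ha
  have h := ellTheta_addition hp (x := X / s) (y := s * t) (u := Y / s) (v := Z / s)
    (by positivity) (by positivity) (by positivity) (by positivity)
  rw [show X / s * (s * t) = X * t by field_simp,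
    show X / s / (s * t) = X / (s ^ 2 * t) by field_simp,
    show Y / s * (Z / s) = Y * Z / s ^ 2 by field_simp, show Y / s / (Z / s) = Y / Z by field_simp,
    show X / s * (Z / s) = X * Z / s ^ 2 by field_simp, show X / s / (Z / s) = X / Z by field_simp,
    show Y / s * (s * t) = Y * t by field_simp,
    show Y / s / (s * t) = Y / (s ^ 2 * t) by field_simp,
    show s * t * (Z / s) = t * Z by field_simp, show s * t / (Z / s) = s ^ 2 * t / Z by field_simp,
    show X / s * (Y / s) = X * Y / s ^ 2 by field_simp,
    show X / s / (Y / s) = X / Y by field_simp] at h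
  exact h

/-- The three-term relation in the form in which four factors multiply to a square. -/
lemma ellTheta_addition_well_poised {p A b c d : ℂ} (hp : ‖p‖ < 1) (hA : A ≠ 0) (hb : b ≠ 0)
    (hc : c ≠ 0) (hd : d ≠ 0) :
    ellTheta A p * ellTheta (A / (c * d)) p * ellTheta (A / (b * d)) p * ellTheta (A / (b * c)) p =
      ellTheta (A / (b * c * d)) p * ellTheta (A / b) p * ellTheta (A / c) p * ellTheta (A / d) p +
      A / (b * c * d) * (ellTheta (A ^ 2 / (b * c * d)) p * ellTheta b p * ellTheta c p *
        ellTheta d p) := by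
  obtain ⟨y, hy⟩ := IsAlgClosed.exists_pow_nat_eq (b * c) (n := 2) (by norm_num)
  have hy0 : y ≠ 0 := by rintro rfl; simp at hy; tauto
  have h := ellTheta_addition hp (x := A / y) (y := y) (u := A * y / (b * c * d)) (v := c / y)
    (by positivity) hy0 (by positivity) (by positivity)
  have e1 : A / y * y = A := by field_simp
  have e2 : A / y / y = A / (b * c) := by rw [← hy]; field_simp
  have e3 : A * y / (b * c * d) * (c / y) = A / (b * d) := by field_simp
  have e4 : A * y / (b * c * d) / (c / y) = A / (c * d) := by
    field_simp; rw [hy]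
  have e5 : A / y * (c / y) = A / b := by field_simp; rw [hy]; ring
  have e6 : A / y / (c / y) = A / c := by field_simp
  have e7 : A * y / (b * c * d) * y = A / d := by field_simp; rw [hy]
  have e8 : A * y / (b * c * d) / y = A / (b * c * d) := by field_simp
  have e9 : y * (c / y) = c := by field_simp
  have e10 : y / (c / y) = b := by field_simp; rw [hy]; ring
  have e11 : A / y * (A * y / (b * c * d)) = A ^ 2 / (b * c * d) := by field_simp
  have e12 : A / y / (A * y / (b * c * d)) = d := by field_simp; rw [hy]
  rw [e1, e2, e3, e4, e5, e6, e7, e8, e9, e10, e11, e12] at h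
  linear_combination h

/-! ### Theta shifted factorials -/

@[simp] lemma ellFac_zero (x q p : ℂ) : ellFac x q p 0 = 1 := by simp [ellFac]

lemma ellFac_succ (x q p : ℂ) (k : ℕ) :
    ellFac x q p (k + 1) = ellFac x q p k * ellTheta (x * q ^ k) p := prod_range_succ _ _

lemma ellFac_succ' (x q p : ℂ) (k : ℕ) :
    ellFac x q p (k + 1) = ellTheta x p * ellFac (x * q) q p k := by
  rw [ellFac, prod_range_succ', mul_comm, pow_zero, mul_one, ellFac]
  congr 1
  exact prod_congr rfl fun i _ => by rw [pow_succ']; ring_nf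

lemma ellFac_add (x q p : ℂ) (m n : ℕ) :
    ellFac x q p (m + n) = ellFac x q p m * ellFac (x * q ^ m) q p n := by
  rw [ellFac, prod_range_add, ellFac, ellFac]
  congr 1
  exact prod_congr rfl fun i _ => by rw [pow_add, mul_assoc]

lemma ellFac_sq {p : ℂ} (hp : ‖p‖ < 1) (x q : ℂ) (k : ℕ) :
    ellFac (x ^ 2) (q ^ 2) (p ^ 2) k = ellFac x q p k * ellFac (-x) q p k := by
  rw [ellFac, ellFac, ellFac, ← prod_mul_distrib]
  refine prod_congr rfl fun i _ => ?_
  rw [← pow_mul, mul_comm 2 i, pow_mul, ← mul_pow, ellTheta_sq hp, neg_mul]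

/-- Reversal of the order of the factors. -/
lemma ellFac_reverse {p q x : ℂ} (hp : ‖p‖ < 1) (hq : q ≠ 0) (hx : x ≠ 0) (k : ℕ) :
    ellFac x q p k = (∏ i ∈ range k, -(x * q ^ i)) * ellFac (q / (x * q ^ k)) q p k := by
  rw [ellFac, ellFac, ← prod_range_reflect (fun i => ellTheta (q / (x * q ^ k) * q ^ i) p),
    ← prod_mul_distrib]
  refine prod_congr rfl fun i hi => ?_
  have hi' := mem_range.mp hi
  obtain ⟨j, rfl⟩ : ∃ j, k = i + 1 + j := ⟨k - (i + 1), by omega⟩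
  rw [show i + 1 + j - 1 - i = j by omega,
    show q / (x * q ^ (i + 1 + j)) * q ^ j = (x * q ^ i)⁻¹ by field_simp; ring,
    ellTheta_inv hp (by positivity)]
  field_simp

lemma ellFac_ne_zero {x q p : ℂ} (h : ∀ k : ℕ, ellTheta (x * q ^ k) p ≠ 0) (k : ℕ) :
    ellFac x q p k ≠ 0 := prod_ne_zero_iff.mpr fun i _ => h i

/-! ### Well-poised matrices and the Frenkel–Turaev summation -/

/-- The entry with indices `n`, `k` of the lower triangular matrix of the well-poised Bailey
transform with parameters `A` and `K` (base `q`, nome `p`). -/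
noncomputable def wpMat (A K q p : ℂ) (n k : ℕ) : ℂ :=
  if k ≤ n then ellFac (K / A) q p (n - k) * ellFac K q p (n + k) /
    (ellFac q q p (n - k) * ellFac (A * q) q p (n + k)) else 0

/-- The very-well-poised factor `θ(A q ^ (2 k); p) / θ(A; p)`. -/
noncomputable def vwpFac (A q p : ℂ) (k : ℕ) : ℂ := ellTheta (A * q ^ (2 * k)) p / ellTheta A p

/-- The term with index `k` of the well-poised Bailey sequence with the three parameters
`b`, `c`, `d`. -/
noncomputable def wpTerm (a b c d K q p : ℂ) (k : ℕ) : ℂ :=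
  vwpFac a q p k * (ellFac a q p k * ellFac b q p k * ellFac c q p k * ellFac d q p k /
    (ellFac q q p k * ellFac (a * q / b) q p k * ellFac (a * q / c) q p k *
      ellFac (a * q / d) q p k)) * (K / a) ^ k

/-- All the theta functions `θ(x q ^ k; p)`, `k ∈ ℤ`, are different from `0`. -/
def NonVan (x q p : ℂ) : Prop := ∀ k : ℤ, ellTheta (x * q ^ k) p ≠ 0

lemma NonVan.shift {x q p : ℂ} (h : NonVan x q p) (hq : q ≠ 0) (m : ℤ) :
    NonVan (x * q ^ m) q p := fun k => by
  rw [mul_assoc, ← zpow_add₀ hq]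
  exact h _

lemma NonVan.theta {x q p : ℂ} (h : NonVan x q p) : ellTheta x p ≠ 0 := by simpa using h 0

lemma NonVan.fac {x q p : ℂ} (h : NonVan x q p) (k : ℕ) : ellFac x q p k ≠ 0 :=
  ellFac_ne_zero (fun k => by simpa using h k) k

/-- Shifting the index `k` of the Bailey sequence amounts to shifting its parameters. -/
lemma wpTerm_succ {a b c d K q p : ℂ} (hq : q ≠ 0) (ha : a ≠ 0) (hK : K ≠ 0) (hb : b ≠ 0)
    (hc : c ≠ 0) (hd : d ≠ 0) (hqn : ∀ k : ℕ, ellTheta (q * q ^ k) p ≠ 0) (han : NonVan a q p)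
    (hbn : NonVan (a / b) q p) (hcn : NonVan (a / c) q p) (hdn : NonVan (a / d) q p) (k : ℕ) :
    ellTheta b p * ellTheta c p * ellTheta d p / (ellTheta (a * q / b) p *
      ellTheta (a * q / c) p * ellTheta (a * q / d) p) *
        wpTerm (a * q ^ 2) (b * q) (c * q) (d * q) (K * q) q p k =
      wpTerm a b c d K q p (k + 1) * (ellTheta (a * q ^ (k + 1)) p * ellTheta (q ^ (k + 1)) p /
        (ellTheta (a * q) p * ellTheta (a * q ^ 2) p)) * (a / (K * q ^ k)) := by
  have hx : ∀ x : ℂ, x ≠ 0 → a * q ^ 2 * q / (x * q) = a * q / x * q := fun x hx => by field_simp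
  have hn : ∀ x : ℂ, NonVan (a / x) q p → NonVan (a * q / x) q p := fun x h => by
    have := h.shift hq 1
    rwa [zpow_one, div_mul_eq_mul_div] at this
  have h1 := han.theta
  have h2 : ellTheta (a * q) p ≠ 0 := by simpa using han 1
  have h3 : ellTheta (a * q ^ 2) p ≠ 0 := by simpa using han 2
  have h4 := hn b hbn
  have h5 := hn c hcn
  have h6 := hn d hdn
  have h7 := h4.fac (k + 1)
  have h8 := h5.fac (k + 1)
  have h9 := h6.fac (k + 1)
  have h10 := hqn k
  have h11 := ellFac_ne_zero hqn k
  have ea : ellTheta a p * ellTheta (a * q) p * ellFac (a * q ^ 2) q p k =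
      ellFac a q p (k + 1) * ellTheta (a * q ^ (k + 1)) p := by
    rw [← ellFac_succ, ellFac_succ', ellFac_succ', pow_two, ← mul_assoc, ← mul_assoc]
  have ew : a * q ^ 2 * q ^ (2 * k) = a * q ^ (2 * (k + 1)) := by ring
  rw [ellFac_succ'] at h7 h8 h9
  have h12 := right_ne_zero_of_mul h7
  have h13 := right_ne_zero_of_mul h8
  have h14 := right_ne_zero_of_mul h9
  unfold wpTerm vwpFac
  rw [hx b hb, hx c hc, hx d hd, ew, ellFac_succ' b, ellFac_succ' c, ellFac_succ' d,
    ellFac_succ' (a * q / b), ellFac_succ' (a * q / c), ellFac_succ' (a * q / d), ellFac_succ q,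
    ← pow_succ' q k, show K * q / (a * q ^ 2) = K / a / q by field_simp, div_pow (K / a),
    pow_succ (K / a)]
  rw [← pow_succ'] at h10
  have ea' : ellFac (a * q ^ 2) q p k = ellFac a q p (k + 1) * ellTheta (a * q ^ (k + 1)) p /
      (ellTheta a p * ellTheta (a * q) p) := by
    rw [← ea]; field_simp
  rw [ea']
  have h15 := h4.theta
  have h16 := h5.theta
  have h17 := h6.theta
  clear ea ea' h4 h5 h6 h7 h8 h9 han hbn hcn hdn hqn hx hn ew
  generalize ellFac (a * q / b * q) q p k = X₁ at *
  generalize ellFac (a * q / c * q) q p k = X₂ at *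
  generalize ellFac (a * q / d * q) q p k = X₃ at *
  generalize ellTheta (a * q / b) p = X₄ at *
  generalize ellTheta (a * q / c) p = X₅ at *
  generalize ellTheta (a * q / d) p = X₆ at *
  generalize ellTheta (a * q ^ (k + 1)) p = X₇ at *
  generalize ellTheta (q ^ (k + 1)) p = X₈ at *
  generalize ellTheta (a * q ^ (2 * (k + 1))) p = X₉ at *
  generalize ellTheta (a * q ^ 2) p = Y₁ at *
  generalize ellTheta (a * q) p = Y₂ at *
  generalize ellFac q q p k = Y₃ at *
  generalize (K / a) ^ k = Y₄
  field_simp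

/-- The elementary recurrence in the first index behind the Frenkel–Turaev summation. -/
lemma wpMat_mul_wpTerm_succ {a b c d K q p : ℂ} (hp : ‖p‖ < 1) (hq : q ≠ 0) (ha : a ≠ 0)
    (hK : K ≠ 0) (hb : b ≠ 0) (hc : c ≠ 0) (hd : d ≠ 0)
    (hqn : ∀ k : ℕ, ellTheta (q * q ^ k) p ≠ 0) (han : NonVan a q p)
    (hbn : NonVan (a / b) q p) (hcn : NonVan (a / c) q p) (hdn : NonVan (a / d) q p) {n k : ℕ}
    (hk : k ≤ n) :
    wpMat a K q p (n + 1) (k + 1) * wpTerm a b c d K q p (k + 1) =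
      ellTheta (K * q ^ n / a) p * ellTheta (K * q ^ n) p /
        (ellTheta (q ^ (n + 1)) p * ellTheta (a * q ^ (n + 1)) p) *
        (wpMat a K q p n (k + 1) * wpTerm a b c d K q p (k + 1)) +
      K / a * q ^ n * ellTheta (K * q ^ (2 * n + 1)) p * ellTheta K p /
          (ellTheta (q ^ (n + 1)) p * ellTheta (a * q ^ (n + 1)) p) *
        (ellTheta b p * ellTheta c p * ellTheta d p / (ellTheta (a * q / b) p *
          ellTheta (a * q / c) p * ellTheta (a * q / d) p)) *
        (wpMat (a * q ^ 2) (K * q) q p n k *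
          wpTerm (a * q ^ 2) (b * q) (c * q) (d * q) (K * q) q p k) := by
  obtain ⟨m, rfl⟩ := Nat.exists_eq_add_of_le hk
  have hA : ∀ x y : ℂ, x * (ellTheta b p * ellTheta c p * ellTheta d p / (ellTheta (a * q / b) p *
      ellTheta (a * q / c) p * ellTheta (a * q / d) p)) *
        (y * wpTerm (a * q ^ 2) (b * q) (c * q) (d * q) (K * q) q p k) = x * y *
      (wpTerm a b c d K q p (k + 1) * (ellTheta (a * q ^ (k + 1)) p * ellTheta (q ^ (k + 1)) p /
        (ellTheta (a * q) p * ellTheta (a * q ^ 2) p)) * (a / (K * q ^ k))) := fun x y => by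
    rw [← wpTerm_succ hq ha hK hb hc hd hqn han hbn hcn hdn]
    ring
  rw [hA]
  have h1 : ellTheta (q ^ (k + m + 1)) p ≠ 0 := by rw [pow_succ']; exact hqn _
  have h2 : ellTheta (a * q ^ (k + m + 1)) p ≠ 0 := by
    rw [← zpow_natCast]; exact han _
  have h3 : ellTheta (a * q) p ≠ 0 := by simpa using han 1
  have h4 : ellTheta (a * q ^ 2) p ≠ 0 := by simpa using han 2
  have h5 : ∀ j, ellFac q q p j ≠ 0 := ellFac_ne_zero hqn
  have h6 : ∀ j, ellFac (a * q) q p j ≠ 0 := fun j => by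
    simpa using (han.shift hq 1).fac j
  have e1 : ellFac (a * q) q p (k + m + 1 + (k + 1)) =
      ellTheta (a * q) p * ellTheta (a * q ^ 2) p * ellFac (a * q ^ 2 * q) q p (k + m + k) := by
    rw [show k + m + 1 + (k + 1) = k + m + k + 1 + 1 by ring, ellFac_succ', ellFac_succ']
    ring_nf
  have e2 : ellFac K q p (k + m + 1 + (k + 1)) =
      ellTheta K p * ellFac (K * q) q p (k + m + k) * ellTheta (K * q ^ (2 * k + m + 1)) p := by
    rw [show k + m + 1 + (k + 1) = k + m + k + 1 + 1 by ring, ellFac_succ, ellFac_succ',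
      show k + m + k + 1 = 2 * k + m + 1 by ring]
  have h7 := h6 (k + m + 1 + (k + 1))
  rw [e1] at h7
  have h8 := right_ne_zero_of_mul h7
  rcases m with _ | m
  · rw [wpMat, wpMat, wpMat, if_pos (by omega), if_neg (by omega), if_pos (by omega), e1, e2,
      show k + 0 + 1 - (k + 1) = 0 by omega, show k + 0 - k = 0 by omega]
    simp only [add_zero, ellFac_zero] at *
    field_simp
    ring
  · -- After division by the common factors, the claim is a single three-term relation.
    have hadd := ellTheta_addition_of_mul_eq hp ha (X := K * q ^ (k + (m + 1)))
      (Y := a * q ^ (k + (m + 1) + 1)) (Z := a) (t := q ^ (k + 1)) (by positivity)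
      (by positivity) ha (by positivity)
    have h9 : ellTheta (q ^ (m + 1)) p ≠ 0 := by rw [pow_succ']; exact hqn _
    rw [show K * q ^ (k + (m + 1)) * q ^ (k + 1) = K * q ^ (2 * k + (m + 1) + 1) by ring,
      show K * q ^ (k + (m + 1)) / (a * q ^ (k + 1)) = K / a * q ^ m by field_simp; ring,
      mul_div_assoc _ a a, div_self ha, mul_one,
      show a * q ^ (k + (m + 1) + 1) / a = q ^ (k + (m + 1) + 1) by field_simp,
      mul_div_assoc _ a a, div_self ha, mul_one,
      show a * q ^ (k + (m + 1) + 1) * q ^ (k + 1) = a * q ^ (k + (m + 1) + (k + 1) + 1) by ring,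
      show a * q ^ (k + (m + 1) + 1) / (a * q ^ (k + 1)) = q ^ (m + 1) by field_simp; ring,
      mul_comm (q ^ (k + 1)) a, mul_div_assoc, mul_div_cancel_left₀ _ ha,
      show K * q ^ (k + (m + 1)) * (a * q ^ (k + (m + 1) + 1)) / a =
        K * q ^ (2 * (k + (m + 1)) + 1) by field_simp; ring,
      show K * q ^ (k + (m + 1)) / (a * q ^ (k + (m + 1) + 1)) = K * q / (a * q ^ 2) by
        field_simp; ring] at hadd
    have e3 : ellFac (K * q / (a * q ^ 2)) q p (m + 1) =
        ellTheta (K * q / (a * q ^ 2)) p * ellFac (K / a) q p m := by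
      rw [ellFac_succ']
      congr 2
      field_simp
    have e4 : ellFac K q p (k + (m + 1) + (k + 1)) =
        ellTheta K p * ellFac (K * q) q p (k + (m + 1) + k) := by
      rw [← add_assoc, ellFac_succ']
    have e5 : ellFac q q p (m + 1) = ellFac q q p m * ellTheta (q ^ (m + 1)) p := by
      rw [ellFac_succ, ← pow_succ']
    have e6 : ellTheta (a * q) p * ellTheta (a * q ^ 2) p *
        ellFac (a * q ^ 2 * q) q p (k + (m + 1) + k) =
        ellFac (a * q) q p (k + (m + 1) + (k + 1)) *
          ellTheta (a * q ^ (k + (m + 1) + (k + 1) + 1)) p := by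
      rw [← e1, show k + (m + 1) + 1 + (k + 1) = k + (m + 1) + (k + 1) + 1 by ring, ellFac_succ,
        mul_assoc a, ← pow_succ']
    have e7 : ellFac (a * q ^ 2 * q) q p (k + (m + 1) + k) =
        ellFac (a * q) q p (k + (m + 1) + (k + 1)) *
          ellTheta (a * q ^ (k + (m + 1) + (k + 1) + 1)) p /
            (ellTheta (a * q) p * ellTheta (a * q ^ 2) p) := by
      rw [← e6]
      field_simp
    have h10 := h5 m
    have h11 := h6 (k + (m + 1) + (k + 1))
    have h12 : ellTheta (a * q ^ (k + (m + 1) + (k + 1) + 1)) p ≠ 0 := by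
      rw [← zpow_natCast]; exact han _
    rw [wpMat, wpMat, wpMat, if_pos (by omega), if_pos (by omega), if_pos (by omega), e1, e2,
      show k + (m + 1) + 1 - (k + 1) = m + 1 by omega, show k + (m + 1) - k = m + 1 by omega,
      show k + (m + 1) - (k + 1) = m by omega, e3, e4, e5, ellFac_succ (K / a), e7]
    generalize wpTerm a b c d K q p (k + 1) = W
    clear hA e1 e2 e3 e4 e5 e6 e7
    generalize ellTheta (K * q / (a * q ^ 2)) p = X₁ at *
    generalize ellTheta (a * q ^ (k + (m + 1) + (k + 1) + 1)) p = X₂ at *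
    generalize ellTheta (K * q ^ (2 * (k + (m + 1)) + 1)) p = X₃ at *
    generalize ellTheta (K * q ^ (2 * k + (m + 1) + 1)) p = X₄ at *
    generalize ellTheta (a * q ^ (k + (m + 1) + 1)) p = X₅ at *
    generalize ellTheta (K / a * q ^ m) p = X₆ at *
    generalize ellTheta (q ^ (m + 1)) p = X₇ at *
    generalize ellTheta (q ^ (k + (m + 1) + 1)) p = X₈ at *
    generalize ellFac (K / a) q p m = F₁ at *
    generalize ellFac (K * q) q p (k + (m + 1) + k) = F₂ at *
    generalize ellFac q q p m = F₃ at *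
    generalize ellFac (a * q) q p (k + (m + 1) + (k + 1)) = F₄ at *
    rw [← mul_div_assoc] at hadd
    field_simp
    linear_combination (F₁ * ellTheta K p * F₂ * W * q ^ k) * hadd

/-- The Frenkel–Turaev summation, written as the evaluation of a well-poised Bailey pair. By
`wpMat_mul_wpTerm_succ` the sum of index `n + 1` is a combination of the sums of index `n` with
parameters `a, b, c, d, K` and `a q², b q, c q, d q, K q`; the balancing condition
`K b c d = a² q` is the same for both. -/
theorem sum_wpMat_mul_wpTerm {p q : ℂ} (hp : ‖p‖ < 1) (hq : q ≠ 0)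
    (hqn : ∀ k : ℕ, ellTheta (q * q ^ k) p ≠ 0) (n : ℕ) :
    ∀ {a b c d K : ℂ}, a ≠ 0 → b ≠ 0 → c ≠ 0 → d ≠ 0 → K ≠ 0 → NonVan a q p →
      NonVan (a / b) q p → NonVan (a / c) q p → NonVan (a / d) q p →
      K * b * c * d = a ^ 2 * q →
      ∑ k ∈ range (n + 1), wpMat a K q p n k * wpTerm a b c d K q p k =
        ellFac K q p n * ellFac (K * b / a) q p n * ellFac (K * c / a) q p n *
          ellFac (K * d / a) q p n /
        (ellFac q q p n * ellFac (a * q / b) q p n * ellFac (a * q / c) q p n *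
          ellFac (a * q / d) q p n) := by
  induction n with
  | zero =>
    intro a b c d K _ _ _ _ _ han _ _ _ _
    simp [wpMat, wpTerm, vwpFac, div_self han.theta]
  | succ n ih =>
    intro a b c d K ha hb hc hd hK han hbn hcn hdn hbal
    have hn : ∀ x : ℂ, NonVan (a / x) q p → NonVan (a * q / x) q p := fun x h => by
      have := h.shift hq 1
      rwa [zpow_one, div_mul_eq_mul_div] at this
    have hs : ∀ x : ℂ, x ≠ 0 → NonVan (a / x) q p → NonVan (a * q ^ 2 / (x * q)) q p :=
      fun x hx h => by
        convert hn x h using 1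
        field_simp
    have han2 : NonVan (a * q ^ 2) q p := by simpa using han.shift hq 2
    have h1 := ih ha hb hc hd hK han hbn hcn hdn hbal
    have h2 := ih (a := a * q ^ 2) (b := b * q) (c := c * q) (d := d * q) (K := K * q)
      (by positivity) (by positivity) (by positivity) (by positivity) (by positivity) han2
      (hs b hb hbn) (hs c hc hcn) (hs d hd hdn) (by linear_combination q ^ 4 * hbal)
    set l := ellTheta (K * q ^ n / a) p * ellTheta (K * q ^ n) p /
        (ellTheta (q ^ (n + 1)) p * ellTheta (a * q ^ (n + 1)) p) with hl
    have h3 : ellTheta (q ^ (n + 1)) p ≠ 0 := by rw [pow_succ']; exact hqn _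
    have h4 : ellTheta (a * q ^ (n + 1)) p ≠ 0 := by rw [← zpow_natCast]; exact han _
    have h5 : ellFac q q p n ≠ 0 := ellFac_ne_zero hqn n
    have hf0 : wpMat a K q p (n + 1) 0 = l * wpMat a K q p n 0 := by
      have h6 : ellFac (a * q) q p n ≠ 0 := by simpa using (han.shift hq 1).fac n
      have e : a * q * q ^ n = a * q ^ (n + 1) := by ring
      simp only [wpMat, Nat.zero_le, if_true, Nat.sub_zero, Nat.add_zero, ellFac_succ, e,
        ← pow_succ', hl, div_mul_eq_mul_div K a]
      field_simp
    rw [sum_range_succ', sum_congr rfl fun k hk => wpMat_mul_wpTerm_succ hp hq ha hK hb hc hd hqn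
      han hbn hcn hdn (Nat.lt_succ_iff.mp (mem_range.mp hk)), sum_add_distrib, ← mul_sum, ← mul_sum,
      h2, hf0, mul_assoc l, add_right_comm, ← mul_add,
      ← sum_range_succ' (fun k => wpMat a K q p n k * wpTerm a b c d K q p k), sum_range_succ, h1]
    have hz : wpMat a K q p n (n + 1) = 0 := if_neg (by omega)
    -- The three-term relation that combines the closed forms of the two sums.
    have hw := ellTheta_addition_well_poised hp (A := a * q ^ (n + 1)) (by positivity) hb hc hd
    have hK' : K = a ^ 2 * q / (b * c * d) := by field_simp; linear_combination hbal
    have g1 : a * q ^ (n + 1) / (c * d) = K * b / a * q ^ n := by rw [hK']; field_simp; ring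
    have g2 : a * q ^ (n + 1) / (b * d) = K * c / a * q ^ n := by rw [hK']; field_simp; ring
    have g3 : a * q ^ (n + 1) / (b * c) = K * d / a * q ^ n := by rw [hK']; field_simp; ring
    have g4 : a * q ^ (n + 1) / (b * c * d) = K * q ^ n / a := by rw [hK']; field_simp; ring
    have g5 : (a * q ^ (n + 1)) ^ 2 / (b * c * d) = K * q ^ (2 * n + 1) := by
      rw [hK']; field_simp; ring
    have g6 : ∀ x, a * q ^ (n + 1) / x = a * q / x * q ^ n := fun x => by ring
    rw [g1, g2, g3, g4, g5, g6, g6, g6] at hw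
    have k1 : ∀ x, x ≠ 0 → K * q * (x * q) / (a * q ^ 2) = K * x / a := fun x hx => by field_simp
    have k2 : ∀ x, x ≠ 0 → a * q ^ 2 * q / (x * q) = a * q / x * q := fun x hx => by field_simp
    have k3 : ∀ x, NonVan (a / x) q p → ellFac (a * q / x) q p n ≠ 0 ∧
        ellTheta (a * q / x * q ^ n) p ≠ 0 ∧ ellFac (a * q / x * q) q p n ≠ 0 ∧
        ellTheta (a * q / x) p ≠ 0 ∧ ellFac (a * q / x) q p n * ellTheta (a * q / x * q ^ n) p =
          ellTheta (a * q / x) p * ellFac (a * q / x * q) q p n := fun x h => by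
      have h' := hn x h
      refine ⟨h'.fac n, by rw [← zpow_natCast]; exact h' _, ?_, h'.theta, ?_⟩
      · simpa using (h'.shift hq 1).fac n
      · rw [← ellFac_succ, ← ellFac_succ']
    obtain ⟨b1, b2, b3, b4, b5⟩ := k3 b hbn
    obtain ⟨c1, c2, c3, c4, c5⟩ := k3 c hcn
    obtain ⟨d1, d2, d3, d4, d5⟩ := k3 d hdn
    have b6 := eq_div_of_mul_eq b4 ((mul_comm _ _).trans b5.symm)
    have c6 := eq_div_of_mul_eq c4 ((mul_comm _ _).trans c5.symm)
    have d6 := eq_div_of_mul_eq d4 ((mul_comm _ _).trans d5.symm)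
    have hKK : ellFac (K * q) q p n * ellTheta K p = ellFac K q p n * ellTheta (K * q ^ n) p := by
      rw [mul_comm, ← ellFac_succ', ellFac_succ]
    rw [hz, zero_mul, add_zero, k1 b hb, k1 c hc, k1 d hd, k2 b hb, k2 c hc, k2 d hd]
    simp only [ellFac_succ, ← pow_succ' q]
    rw [b6, c6, d6]
    clear hbal hK' hqn han hbn hcn hdn han2 b3 c3 d3 hz k1 k2 k3 g1 g2 g3 g4 g5 g6 hf0 h1 h2 ih hs hn
      b6 c6 d6 b5 c5 d5 hl l
    generalize ellTheta (a * q / b * q ^ n) p = B₁ at *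
    generalize ellTheta (a * q / c * q ^ n) p = C₁ at *
    generalize ellTheta (a * q / d * q ^ n) p = D₁ at *
    generalize ellTheta (a * q / b) p = B₂ at *
    generalize ellTheta (a * q / c) p = C₂ at *
    generalize ellTheta (a * q / d) p = D₂ at *
    generalize ellTheta (K * b / a * q ^ n) p = B₃ at *
    generalize ellTheta (K * c / a * q ^ n) p = C₃ at *
    generalize ellTheta (K * d / a * q ^ n) p = D₃ at *
    generalize ellFac (a * q / b) q p n = B₄ at *
    generalize ellFac (a * q / c) q p n = C₄ at *
    generalize ellFac (a * q / d) q p n = D₄ at *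
    generalize ellFac (K * b / a) q p n = B₅ at *
    generalize ellFac (K * c / a) q p n = C₅ at *
    generalize ellFac (K * d / a) q p n = D₅ at *
    generalize ellTheta (q ^ (n + 1)) p = Q₁ at *
    generalize ellFac q q p n = Q₂ at *
    generalize ellTheta (K * q ^ n) p = K₁ at *
    generalize ellTheta (K * q ^ (2 * n + 1)) p = K₂ at *
    generalize ellTheta (a * q ^ (n + 1)) p = A₁ at *
    generalize ellTheta (K * q ^ n / a) p = A₂ at *
    field_simp at hw
    field_simp
    linear_combination (-(K₁ * ellFac K q p n * B₅ * C₅ * D₅)) * hw +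
      (B₅ * C₅ * D₅ * K * q ^ n * K₂ * ellTheta b p * ellTheta c p * ellTheta d p) * hKK

/-! ### Inversion of the well-poised matrices -/

lemma wpMat_of_lt {A K q p : ℂ} {n k : ℕ} (h : n < k) : wpMat A K q p n k = 0 :=
  if_neg (by omega)

lemma wpMat_add_add {A K q p : ℂ} (hq : q ≠ 0) (m n k : ℕ) :
    wpMat A K q p (m + n) (m + k) = ellFac K q p (2 * m) / ellFac (A * q) q p (2 * m) *
      wpMat (A * q ^ (2 * m)) (K * q ^ (2 * m)) q p n k := by
  rw [wpMat, wpMat]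
  by_cases h : k ≤ n
  · rw [if_pos h, if_pos (by omega), show m + n - (m + k) = n - k by omega,
      show m + n + (m + k) = 2 * m + (n + k) by ring, ellFac_add K, ellFac_add (A * q),
      mul_div_mul_right _ _ (pow_ne_zero _ hq), mul_right_comm A q]
    ring
  · rw [if_neg h, if_neg (by omega), mul_zero]

lemma vwpFac_zero {A q p : ℂ} (h : ellTheta A p ≠ 0) : vwpFac A q p 0 = 1 := by
  simp [vwpFac, div_self h]

lemma vwpFac_add {A q p : ℂ} {m : ℕ} (h : ellTheta (A * q ^ (2 * m)) p ≠ 0) (k : ℕ) :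
    vwpFac A q p (m + k) = vwpFac A q p m * vwpFac (A * q ^ (2 * m)) q p k := by
  rw [vwpFac, vwpFac, vwpFac, mul_assoc A, ← pow_add, ← mul_add]
  field_simp

/-- The well-poised factors relate `(A)_{2m}` to `(Aq)_{2m}`. -/
lemma vwpFac_mul_ellFac {A q p : ℂ} (hA : ellTheta A p ≠ 0) (m : ℕ) :
    vwpFac A q p m * ellFac A q p (2 * m) = ellFac (A * q) q p (2 * m) := by
  have h := ellFac_succ A q p (2 * m)
  rw [ellFac_succ'] at h
  rw [vwpFac]
  field_simp
  linear_combination -h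

/-- The entries of the inverse of the matrix `wpMat`. -/
noncomputable def wpInv (A K q p : ℂ) (n k : ℕ) : ℂ :=
  vwpFac A q p n * vwpFac K q p k * wpMat K A q p n k * (K / A) ^ (n - k)

lemma sum_range_extend {f : ℕ → ℂ} {n N : ℕ} (h : n ≤ N) (hf : ∀ k, n < k → f k = 0) :
    ∑ k ∈ range (N + 1), f k = ∑ k ∈ range (n + 1), f k :=
  (sum_subset (range_subset_range.mpr (by omega)) fun k _ hk => hf k (by
    simpa [Nat.lt_succ_iff] using hk)).symm

lemma sum_range_of_lower {f : ℕ → ℂ} (m n : ℕ) (hf : ∀ k, k < m → f k = 0) :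
    ∑ k ∈ range (m + n + 1), f k = ∑ k ∈ range (n + 1), f (m + k) := by
  rw [add_assoc, sum_range_add, sum_eq_zero fun k hk => hf k (mem_range.mp hk), zero_add]

/-- The case of column `0`: with the parameters `A / K`, `K`, `A q / K` the Frenkel–Turaev sum is
evaluated by a product that contains the factor `θ(1; p) = 0`. -/
lemma sum_wpMat_mul_wpInv_zero {A K q p : ℂ} (hp : ‖p‖ < 1) (hq : q ≠ 0) (hA : A ≠ 0) (hK : K ≠ 0)
    (hqn : ∀ k : ℕ, ellTheta (q * q ^ k) p ≠ 0) (hAn : NonVan A q p) (hKn : NonVan K q p)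
    (hAK : NonVan (A / K) q p) (n : ℕ) :
    ∑ k ∈ range (n + 1), wpMat A K q p n k * wpInv A K q p k 0 = if n = 0 then 1 else 0 := by
  have h1 := sum_wpMat_mul_wpTerm hp hq hqn n (a := A) (b := A / K) (c := K) (d := A * q / K)
    (K := K) hA (by positivity) hK (by positivity) hK hAn
    (by rwa [show A / (A / K) = K by field_simp]) hAK
    (by
      have := hKn.shift hq (-1)
      rwa [show A / (A * q / K) = K * q ^ (-1 : ℤ) by rw [zpow_neg_one]; field_simp])
    (by field_simp)
  have h2 : ∀ k, wpTerm A (A / K) K (A * q / K) K q p k = wpInv A K q p k 0 := fun k => by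
    have e1 : ellFac (A * q / K) q p k ≠ 0 := by
      have := (hAK.shift hq 1).fac k
      rwa [zpow_one, div_mul_eq_mul_div] at this
    have e2 := hKn.fac k
    rw [wpTerm, wpInv, wpMat, if_pos (Nat.zero_le _), vwpFac_zero hKn.theta,
      show A * q / (A / K) = K * q by field_simp, show A * q / (A * q / K) = K by field_simp,
      Nat.sub_zero, Nat.add_zero]
    field_simp
  simp only [h2] at h1
  rw [h1]
  rcases n with _ | n
  · simp
  · rw [show K * (A / K) / A = 1 by field_simp, ellFac_succ' 1, ellTheta_one hp]
    simp

/-- The matrices `wpMat` and `wpInv` are inverse to each other. A shift of the indices by `m` is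
absorbed into the parameters, which reduces column `m` to column `0`. -/
lemma sum_wpMat_mul_wpInv {A K q p : ℂ} (hp : ‖p‖ < 1) (hq : q ≠ 0) (hA : A ≠ 0) (hK : K ≠ 0)
    (hqn : ∀ k : ℕ, ellTheta (q * q ^ k) p ≠ 0) (hAn : NonVan A q p) (hKn : NonVan K q p)
    (hAK : NonVan (A / K) q p) {n N : ℕ} (hN : n ≤ N) (m : ℕ) :
    ∑ k ∈ range (N + 1), wpMat A K q p n k * wpInv A K q p k m = if n = m then 1 else 0 := by
  rw [sum_range_extend hN fun k hk => by rw [wpMat_of_lt hk, zero_mul]]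
  rcases lt_or_ge n m with h | h
  · rw [if_neg h.ne]
    refine sum_eq_zero fun k hk => ?_
    rw [wpInv, wpMat_of_lt (n := k) (k := m) (by have := mem_range.mp hk; omega)]
    simp
  obtain ⟨t, rfl⟩ := Nat.exists_eq_add_of_le h
  rw [sum_range_of_lower m t fun k hk => by rw [wpInv, wpMat_of_lt (n := k) (k := m) hk]; simp]
  have hsh : ∀ {x : ℂ}, NonVan x q p → NonVan (x * q ^ (2 * m)) q p := fun hx => by
    have := hx.shift hq (2 * m : ℕ)
    rwa [zpow_natCast] at this
  have hK1 : ∀ j, ellFac (K * q) q p j ≠ 0 := fun j => by simpa using (hKn.shift hq 1).fac j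
  have hA1 : ∀ j, ellFac (A * q) q p j ≠ 0 := fun j => by simpa using (hAn.shift hq 1).fac j
  have hdiv : K * q ^ (2 * m) / (A * q ^ (2 * m)) = K / A :=
    mul_div_mul_right _ _ (pow_ne_zero _ hq)
  have key : ∀ s, wpMat A K q p (m + t) (m + s) * wpInv A K q p (m + s) m =
      wpMat (A * q ^ (2 * m)) (K * q ^ (2 * m)) q p t s *
        wpInv (A * q ^ (2 * m)) (K * q ^ (2 * m)) q p s 0 := fun s => by
    have hm := wpMat_add_add (A := K) (K := A) (p := p) hq m s 0
    rw [Nat.add_zero] at hm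
    rw [wpInv, hm, wpMat_add_add hq, vwpFac_add (hsh hAn).theta, wpInv, hdiv,
      vwpFac_zero (hsh hKn).theta, Nat.sub_zero, Nat.add_sub_cancel_left]
    have e1 := vwpFac_mul_ellFac (q := q) hAn.theta m
    have e2 := vwpFac_mul_ellFac (q := q) hKn.theta m
    have e3 := hK1 (2 * m)
    have e4 := hA1 (2 * m)
    rw [← e1] at e4 ⊢
    rw [← e2] at e3 ⊢
    have e5 := left_ne_zero_of_mul e4
    have e6 := right_ne_zero_of_mul e4
    have e7 := left_ne_zero_of_mul e3
    have e8 := right_ne_zero_of_mul e3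
    field_simp
  rw [sum_congr rfl fun s _ => key s, sum_wpMat_mul_wpInv_zero hp hq (by positivity)
    (by positivity) hqn (hsh hAn) (hsh hKn) (by
      rwa [mul_div_mul_right _ _ (pow_ne_zero _ hq)])]
  simp

/-! ### The quadratic connection between two well-poised matrices -/

/-- Evaluation of a theta shifted factorial of length `t - s` in terms of those of lengths `t`
and `s`, in a form free of divisions. -/
lemma ellFac_sub {x q p : ℂ} (hp : ‖p‖ < 1) (hq : q ≠ 0) (hx : x ≠ 0) {s t : ℕ} (h : s ≤ t) :
    ellFac x q p (t - s) * (x ^ s * ∏ i ∈ range s, -(q ^ (t - s) * q ^ i)) *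
      ellFac (q / (x * q ^ t)) q p s = ellFac x q p t := by
  conv_rhs => rw [← Nat.sub_add_cancel h, ellFac_add, ellFac_reverse (x := x * q ^ (t - s)) hp hq
    (by positivity), mul_assoc x, ← pow_add, Nat.sub_add_cancel h]
  rw [← card_range s, ← prod_const, card_range, ← prod_mul_distrib, mul_assoc]
  congr 2
  exact prod_congr rfl fun i _ => by ring

/-- A well-poised quotient in terms of the quotient with `s = 0`. -/
lemma ellFac_div_ellFac {x x' z z' q p : ℂ} (hp : ‖p‖ < 1) (hq : q ≠ 0) (hx : x ≠ 0) (hx' : x' ≠ 0)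
    {s t : ℕ} (hst : s ≤ t) (h1 : ellFac (q / (x * q ^ t)) q p s ≠ 0)
    (h2 : ellFac x' q p t ≠ 0) :
    ellFac x q p (t - s) * ellFac z q p (t + s) / (ellFac x' q p (t - s) * ellFac z' q p (t + s)) =
      ellFac x q p t * ellFac z q p t / (ellFac x' q p t * ellFac z' q p t) *
        (ellFac (z * q ^ t) q p s * ellFac (q / (x' * q ^ t)) q p s /
          (ellFac (q / (x * q ^ t)) q p s * ellFac (z' * q ^ t) q p s)) * (x' / x) ^ s := by
  have hc : ∏ i ∈ range s, -(q ^ (t - s) * q ^ i) ≠ 0 :=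
    prod_ne_zero_iff.mpr fun i _ => neg_ne_zero.mpr (by positivity)
  have e1 := ellFac_sub (p := p) hp hq hx hst
  have e2 := ellFac_sub (p := p) hp hq hx' hst
  rw [← e2] at h2
  have h3 := right_ne_zero_of_mul h2
  have h4 := left_ne_zero_of_mul (left_ne_zero_of_mul h2)
  rw [ellFac_add z, ellFac_add z', ← e1, ← e2]
  generalize ∏ i ∈ range s, -(q ^ (t - s) * q ^ i) = c at *
  rw [div_pow]
  by_cases h5 : ellFac z' q p t = 0
  · simp [h5]
  by_cases h6 : ellFac (z' * q ^ t) q p s = 0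
  · simp [h6]
  have h7 := pow_ne_zero s hx
  have h8 := pow_ne_zero s hx'
  clear e1 e2 h2
  generalize ellFac (q / (x * q ^ t)) q p s = X₁ at *
  generalize ellFac (q / (x' * q ^ t)) q p s = X₂ at *
  generalize ellFac (z' * q ^ t) q p s = X₃ at *
  field_simp

lemma NonVan.of_sq {x q p : ℂ} (hp : ‖p‖ < 1) (h : NonVan (x ^ 2) (q ^ 2) (p ^ 2)) :
    NonVan x q p ∧ NonVan (-x) q p := by
  have h' : ∀ k : ℤ, ellTheta (x * q ^ k) p * ellTheta (-x * q ^ k) p ≠ 0 := fun k => by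
    have := h k
    rwa [← zpow_natCast q 2, ← zpow_mul, mul_comm _ k, zpow_mul, zpow_natCast, ← mul_pow,
      ellTheta_sq hp, ← neg_mul] at this
  exact ⟨fun k => left_ne_zero_of_mul (h' k), fun k => right_ne_zero_of_mul (h' k)⟩

lemma ellTheta_ne_zero_of_sq {q p : ℂ} (hp : ‖p‖ < 1)
    (h : ∀ k : ℕ, ellTheta (q ^ 2 * (q ^ 2) ^ k) (p ^ 2) ≠ 0) (k : ℕ) :
    ellTheta (q * q ^ k) p ≠ 0 ∧ ellTheta (-q * q ^ k) p ≠ 0 := by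
  have := h k
  rw [← pow_mul, mul_comm 2 k, pow_mul, ← mul_pow, ellTheta_sq hp, ← neg_mul] at this
  exact ⟨left_ne_zero_of_mul this, right_ne_zero_of_mul this⟩

/-- Parameters `a`, `b`, base `q` and nome `p` for which no theta function in the denominators of
the quadratic connection formula vanishes. -/
structure QuadGeneric (a b q p : ℂ) : Prop where
  norm_lt : ‖p‖ < 1
  a_ne : a ≠ 0
  b_ne : b ≠ 0
  q_ne : q ≠ 0
  base : ∀ k : ℕ, ellTheta (q ^ 2 * (q ^ 2) ^ k) (p ^ 2) ≠ 0
  a_sq : NonVan (a ^ 2) (q ^ 2) (p ^ 2)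
  b_sq : NonVan (b ^ 2) (q ^ 2) (p ^ 2)
  a_mul_b : NonVan (a * b * q) (q ^ 2) (p ^ 2)
  b_div_a : NonVan (b / (a * q)) (q ^ 2) (p ^ 2)
  mul_q_div_b : NonVan (a * q / b) (q ^ 2) (p ^ 2)
  a_div_b : NonVan (a / (b * q)) (q ^ 2) (p ^ 2)

namespace QuadGeneric

variable {a b q p : ℂ}

lemma norm_sq_lt (h : QuadGeneric a b q p) : ‖p ^ 2‖ < 1 := by
  rw [norm_pow]
  exact pow_lt_one₀ (norm_nonneg _) h.norm_lt (by norm_num)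

lemma shift (h : QuadGeneric a b q p) (m : ℕ) :
    QuadGeneric (a * q ^ (2 * m)) (b * q ^ (2 * m)) q p := by
  have hq := h.q_ne
  have ha := h.a_ne
  have hb := h.b_ne
  have hs : ∀ {x : ℂ}, NonVan x (q ^ 2) (p ^ 2) → NonVan (x * q ^ (4 * m)) (q ^ 2) (p ^ 2) :=
    fun {x} hx => by
      have := hx.shift (pow_ne_zero 2 hq) (2 * m : ℕ)
      rwa [zpow_natCast, ← pow_mul, ← mul_assoc] at this
  refine ⟨h.norm_lt, by positivity, by positivity, hq, h.base, ?_, ?_, ?_, ?_, ?_, ?_⟩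
  · convert hs h.a_sq using 1
    ring
  · convert hs h.b_sq using 1
    ring
  · convert hs h.a_mul_b using 1
    ring
  · convert h.b_div_a using 1
    field_simp
  · convert h.mul_q_div_b using 1
    field_simp
  · convert h.a_div_b using 1
    field_simp

/-- In terms of a square root `y` of `a b q`, the sum is a Frenkel–Turaev sum with parameters
`b / a`, `-y q ^ t` and `-q ^ (-t)`. -/
lemma sum_quadratic_zero (h : QuadGeneric a b q p) (t : ℕ) :
    ∑ s ∈ range (t + 1), wpMat (b ^ 2) (a * b * q) (q ^ 2) (p ^ 2) t s *
        (vwpFac b q p s * wpMat a b q p s 0 * (a / b) ^ s) =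
      (a / b) ^ t * (ellFac (-a * q) q p (2 * t) / ellFac (-b * q) q p (2 * t)) *
        wpMat (a ^ 2) (a * b * q) (q ^ 2) (p ^ 2) t 0 := by
  have ⟨hp, ha, hb, hq, hqn, han2, hbn2, _, hba, _, _⟩ := h
  obtain ⟨han, han'⟩ := han2.of_sq hp
  obtain ⟨hbn, hbn'⟩ := hbn2.of_sq hp
  obtain ⟨y, hy⟩ := IsAlgClosed.exists_pow_nat_eq (a * b * q) (n := 2) (by norm_num)
  have hy0 : y ≠ 0 := by
    rintro rfl
    have : a * b * q ≠ 0 := by positivity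
    simp at hy
    tauto
  have hby : NonVan (b / y) q p ∧ NonVan (-(b / y)) q p := NonVan.of_sq hp (by
    rwa [div_pow, hy, show b ^ 2 / (a * b * q) = b / (a * q) by field_simp])
  have hq1 := fun k => (ellTheta_ne_zero_of_sq hp hqn k).1
  have hq2 := fun k => (ellTheta_ne_zero_of_sq hp hqn k).2
  have hbal : y * (b / a) * (-y * q ^ t) * (-(q ^ t)⁻¹) = b ^ 2 * q := by
    field_simp
    rw [hy]
    ring
  have hFT := sum_wpMat_mul_wpTerm hp hq hq1 t (a := b) (b := b / a) (c := -y * q ^ t)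
    (d := -(q ^ t)⁻¹) (K := y) hb (by positivity) (mul_ne_zero (neg_ne_zero.mpr hy0) (by positivity))
    (neg_ne_zero.mpr (by positivity)) hy0 hbn
    (by rwa [show b / (b / a) = a by field_simp])
    (by
      have := hby.2.shift hq (-t)
      rwa [zpow_neg, zpow_natCast, show -(b / y) * (q ^ t)⁻¹ = b / (-y * q ^ t) by
        field_simp] at this)
    (by
      have := hbn'.shift hq t
      rwa [zpow_natCast, show -b * q ^ t = b / (-(q ^ t)⁻¹) by field_simp] at this)
    hbal
  set G := ellFac (-(y / b)) q p t * ellFac (-y) q p t /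
    (ellFac (-q) q p t * ellFac (-(b * q)) q p t) with hG
  have key : ∀ s ∈ range (t + 1), wpMat (b ^ 2) (a * b * q) (q ^ 2) (p ^ 2) t s *
        (vwpFac b q p s * wpMat a b q p s 0 * (a / b) ^ s) =
      G * (wpMat b y q p t s * wpTerm b (b / a) (-y * q ^ t) (-(q ^ t)⁻¹) y q p s) := by
    intro s hs
    have hst : s ≤ t := Nat.lt_succ_iff.mp (mem_range.mp hs)
    have hr := ellFac_div_ellFac (p := p) (x := -(y / b)) (x' := -q) (z := -y) (z' := -(b * q)) hp hq
      (neg_ne_zero.mpr (by positivity)) (neg_ne_zero.mpr hq) hst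
      (by
        have := (hby.2.shift hq (1 - t)).fac s
        rwa [zpow_sub₀ hq, zpow_one, zpow_natCast,
          show -(b / y) * (q / q ^ t) = q / (-(y / b) * q ^ t) by field_simp] at this)
      (ellFac_ne_zero hq2 t)
    have hsplit : wpMat (b ^ 2) (a * b * q) (q ^ 2) (p ^ 2) t s = wpMat b y q p t s *
        (ellFac (-(y / b)) q p (t - s) * ellFac (-y) q p (t + s) /
          (ellFac (-q) q p (t - s) * ellFac (-(b * q)) q p (t + s))) := by
      rw [wpMat, wpMat, if_pos hst, if_pos hst, ← hy, ← div_pow, ← mul_pow, ellFac_sq hp,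
        ellFac_sq hp, ellFac_sq hp, ellFac_sq hp]
      ring
    rw [hsplit, hr, ← hG, wpTerm, wpMat, wpMat, if_pos hst, if_pos (Nat.zero_le s), Nat.sub_zero,
      Nat.add_zero, show b * q / (b / a) = a * q by field_simp,
      show b * q / (-(q ^ t)⁻¹) = -(b * q) * q ^ t by field_simp,
      show q / (-q * q ^ t) = -(q ^ t)⁻¹ by field_simp,
      show q / (-(y / b) * q ^ t) = b * q / (-y * q ^ t) by field_simp]
    have hpow : (-q / -(y / b)) ^ s * (a / b) ^ s = (y / b) ^ s := by
      rw [← mul_pow]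
      congr 1
      field_simp
      rw [hy]
      ring
    rw [← hpow]
    ring
  have e1 := ellFac_reverse (p := p) (x := -(y / b)) hp hq (neg_ne_zero.mpr (by positivity)) t
  have e2 := ellFac_reverse (p := p) (x := -(y / a)) hp hq (neg_ne_zero.mpr (by positivity)) t
  have e3 : ∏ i ∈ range t, -(-(y / b) * q ^ i) = (a / b) ^ t * ∏ i ∈ range t, -(-(y / a) * q ^ i) := by
    rw [← card_range t, ← prod_const, card_range, ← prod_mul_distrib]
    exact prod_congr rfl fun i _ => by field_simp
  have e4 : ellFac (q / (-(y / b) * q ^ t)) q p t ≠ 0 := by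
    have := (hby.2.shift hq (1 - t)).fac t
    rwa [zpow_sub₀ hq, zpow_one, zpow_natCast,
      show -(b / y) * (q / q ^ t) = q / (-(y / b) * q ^ t) by field_simp] at this
  have e5 := ellFac_ne_zero hq1 t
  have e6 := ellFac_ne_zero hq2 t
  have e7 : ellFac (a * q) q p t ≠ 0 := by simpa using (han.shift hq 1).fac t
  have e7' : ellFac (-(a * q)) q p t ≠ 0 := by simpa using (han'.shift hq 1).fac t
  have e8 : ∀ j, ellFac (-(b * q)) q p j ≠ 0 := fun j => by
    simpa using (hbn'.shift hq 1).fac j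
  have e9 := e8 (t + t)
  rw [ellFac_add] at e9
  rw [sum_congr rfl key, ← mul_sum, hFT, wpMat, if_pos (Nat.zero_le t), Nat.sub_zero, Nat.add_zero,
    ← hy, ← div_pow, ← mul_pow, ellFac_sq hp, ellFac_sq hp, ellFac_sq hp, ellFac_sq hp, two_mul,
    neg_mul a, neg_mul b, ellFac_add, ellFac_add (-(b * q)),
    show y * (b / a) / b = y / a by field_simp,
    show y * (-y * q ^ t) / b = -(a * q) * q ^ t by field_simp; rw [hy]; ring,
    show y * -(q ^ t)⁻¹ / b = q / (-(y / a) * q ^ t) by field_simp; rw [hy]; ring,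
    show b * q / (b / a) = a * q by field_simp,
    show b * q / (-y * q ^ t) = q / (-(y / b) * q ^ t) by field_simp,
    show b * q / (-(q ^ t)⁻¹) = -(b * q) * q ^ t by field_simp, hG, e1, e2, e3]
  have e10 := left_ne_zero_of_mul e9
  have e11 := right_ne_zero_of_mul e9
  clear e1 e2 e3 e8 e9 hG key hFT
  generalize ellFac (q / (-(y / b) * q ^ t)) q p t = X₁ at *
  generalize ellFac (q / (-(y / a) * q ^ t)) q p t = X₂ at *
  generalize ellFac (-(b * q) * q ^ t) q p t = X₃ at *
  generalize ellFac (-(a * q) * q ^ t) q p t = X₄ at *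
  generalize ellFac (y / a) q p t = X₅ at *
  generalize ∏ i ∈ range t, -(-(y / a) * q ^ i) = X₆ at *
  generalize (a / b) ^ t = X₇ at *
  generalize ellFac (-(b * q)) q p t = X₈ at *
  generalize ellFac (a * q) q p t = X₉ at *
  generalize ellFac (-(a * q)) q p t = Y₁ at *
  field_simp

/-- The first connection formula: the entries of `wpMat (a²) (a b q) (q²) (p²)` as sums over the
entries of `wpMat a b q p`. -/
lemma sum_quadratic (h : QuadGeneric a b q p) {r N : ℕ} (hN : r ≤ N) (k : ℕ) :
    ∑ n ∈ range (N + 1), wpMat (b ^ 2) (a * b * q) (q ^ 2) (p ^ 2) r n *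
        (vwpFac b q p n * wpMat a b q p n k * (a / b) ^ n) =
      (a / b) ^ r * (ellFac (-a * q) q p (2 * r) / ellFac (-b * q) q p (2 * r)) *
        wpMat (a ^ 2) (a * b * q) (q ^ 2) (p ^ 2) r k := by
  have ⟨hp, ha, hb, hq, hqn, han2, hbn2, _, hba, _, _⟩ := h
  obtain ⟨han, han'⟩ := han2.of_sq hp
  obtain ⟨hbn, hbn'⟩ := hbn2.of_sq hp
  rw [sum_range_extend hN fun n hn => by rw [wpMat_of_lt hn, zero_mul]]
  rcases lt_or_ge r k with hrk | hrk
  · rw [wpMat_of_lt hrk, mul_zero]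
    refine sum_eq_zero fun n hn => ?_
    rw [wpMat_of_lt (n := n) (k := k) (by have := mem_range.mp hn; omega)]
    ring
  obtain ⟨t, rfl⟩ := Nat.exists_eq_add_of_le hrk
  rw [sum_range_of_lower k t fun n hn => by rw [wpMat_of_lt (n := n) (k := k) hn]; ring]
  have hz := sum_quadratic_zero (h.shift k) t
  have hq2 : q ^ 2 ≠ 0 := pow_ne_zero _ hq
  have hb' : ellTheta (b * q ^ (2 * k)) p ≠ 0 := by rw [← zpow_natCast]; exact hbn _
  have f1 : (a * q ^ (2 * k)) ^ 2 = a ^ 2 * (q ^ 2) ^ (2 * k) := by ring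
  have f2 : (b * q ^ (2 * k)) ^ 2 = b ^ 2 * (q ^ 2) ^ (2 * k) := by ring
  have f3 : a * q ^ (2 * k) * (b * q ^ (2 * k)) * q = a * b * q * (q ^ 2) ^ (2 * k) := by ring
  have f4 : a * q ^ (2 * k) / (b * q ^ (2 * k)) = a / b :=
    mul_div_mul_right _ _ (pow_ne_zero _ hq)
  have f5 : ∀ x : ℂ, -(x * q ^ (2 * k)) * q = -x * q * q ^ (2 * k) := fun x => by ring
  rw [f1, f2, f3, f4, f5, f5] at hz
  have m1 := fun s => wpMat_add_add (A := b ^ 2) (K := a * b * q) (p := p ^ 2) hq2 k t s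
  have m2 := fun s => wpMat_add_add (A := a) (K := b) (p := p) hq k s 0
  have m3 := wpMat_add_add (A := a ^ 2) (K := a * b * q) (p := p ^ 2) hq2 k t 0
  simp only [Nat.add_zero] at m2 m3
  simp only [m1, m2, m3, vwpFac_add hb']
  have hL : ∀ s, ellFac (a * b * q) (q ^ 2) (p ^ 2) (2 * k) /
        ellFac (b ^ 2 * q ^ 2) (q ^ 2) (p ^ 2) (2 * k) *
      wpMat (b ^ 2 * (q ^ 2) ^ (2 * k)) (a * b * q * (q ^ 2) ^ (2 * k)) (q ^ 2) (p ^ 2) t s *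
      (vwpFac b q p k * vwpFac (b * q ^ (2 * k)) q p s * (ellFac b q p (2 * k) /
        ellFac (a * q) q p (2 * k) * wpMat (a * q ^ (2 * k)) (b * q ^ (2 * k)) q p s 0) *
          (a / b) ^ (k + s)) =
      (ellFac (a * b * q) (q ^ 2) (p ^ 2) (2 * k) / ellFac (b ^ 2 * q ^ 2) (q ^ 2) (p ^ 2) (2 * k) *
        (vwpFac b q p k * ellFac b q p (2 * k)) / ellFac (a * q) q p (2 * k) * (a / b) ^ k) *
      (wpMat (b ^ 2 * (q ^ 2) ^ (2 * k)) (a * b * q * (q ^ 2) ^ (2 * k)) (q ^ 2) (p ^ 2) t s *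
        (vwpFac (b * q ^ (2 * k)) q p s * wpMat (a * q ^ (2 * k)) (b * q ^ (2 * k)) q p s 0 *
          (a / b) ^ s)) := fun s => by
    rw [pow_add]
    ring
  rw [sum_congr rfl fun s _ => hL s, ← mul_sum, hz, vwpFac_mul_ellFac hbn.theta, ← mul_pow b,
    ← mul_pow a, ellFac_sq hp, ellFac_sq hp, mul_add, ellFac_add (-a * q), ellFac_add (-b * q),
    pow_add, neg_mul, neg_mul]
  have e1 : ellFac (b * q) q p (2 * k) ≠ 0 := by simpa using (hbn.shift hq 1).fac (2 * k)
  have e2 : ellFac (-(a * q)) q p (2 * k) ≠ 0 := by simpa using (han'.shift hq 1).fac (2 * k)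
  field_simp

end QuadGeneric

namespace QuadGeneric

variable {a b q p : ℂ}

/-- The second connection formula, obtained from the first one by inverting the matrix
`wpMat (b²) (a b q) (q²) (p²)`. -/
lemma sum_connection (h : QuadGeneric a b q p) {m N : ℕ} (hN : m ≤ N) (k : ℕ) :
    ∑ r ∈ range (N + 1), wpMat (a * b * q) (b ^ 2) (q ^ 2) (p ^ 2) m r *
        (vwpFac (a * b * q) (q ^ 2) (p ^ 2) r *
          (ellFac (-a * q) q p (2 * r) / ellFac (-b * q) q p (2 * r)) * (q ^ r)⁻¹) *
        wpMat (a ^ 2) (a * b * q) (q ^ 2) (p ^ 2) r k =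
      ellTheta (-b) p / ellTheta (-b * q ^ (2 * m)) p * (q ^ m)⁻¹ * wpMat a b q p m k := by
  have ⟨hp, ha, hb, hq, hqn, han2, hbn2, hab, hba, habq, _⟩ := h
  obtain ⟨hbn, hbn'⟩ := hbn2.of_sq hp
  have hb1 : ∀ n : ℕ, ellTheta (b * q ^ (2 * n)) p ≠ 0 := fun n => by
    rw [← zpow_natCast]; exact hbn _
  have hb2 : ∀ n : ℕ, ellTheta (-b * q ^ (2 * n)) p ≠ 0 := fun n => by
    rw [← zpow_natCast]; exact hbn' _
  have hv : ∀ n, vwpFac (b ^ 2) (q ^ 2) (p ^ 2) n =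
      vwpFac b q p n * (ellTheta (-b * q ^ (2 * n)) p / ellTheta (-b) p) := fun n => by
    rw [vwpFac, vwpFac, ← pow_mul, mul_comm 2 (2 * n), pow_mul q (2 * n) 2, ← mul_pow,
      ellTheta_sq hp, ellTheta_sq hp, ← neg_mul]
    exact mul_div_mul_comm _ _ _ _
  have key : ∀ r ∈ range (N + 1), wpMat (a * b * q) (b ^ 2) (q ^ 2) (p ^ 2) m r *
        (vwpFac (a * b * q) (q ^ 2) (p ^ 2) r *
          (ellFac (-a * q) q p (2 * r) / ellFac (-b * q) q p (2 * r)) * (q ^ r)⁻¹) *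
        wpMat (a ^ 2) (a * b * q) (q ^ 2) (p ^ 2) r k =
      ∑ n ∈ range (N + 1), (wpMat (a * b * q) (b ^ 2) (q ^ 2) (p ^ 2) m r *
        wpInv (a * b * q) (b ^ 2) (q ^ 2) (p ^ 2) r n) *
        (ellTheta (-b) p / ellTheta (-b * q ^ (2 * n)) p * (q ^ n)⁻¹ * wpMat a b q p n k) := by
    intro r hr
    have h3 := h.sum_quadratic (Nat.lt_succ_iff.mp (mem_range.mp hr)) k
    have h4 : ellFac (-a * q) q p (2 * r) / ellFac (-b * q) q p (2 * r) *
        wpMat (a ^ 2) (a * b * q) (q ^ 2) (p ^ 2) r k = (b / a) ^ r *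
        ∑ n ∈ range (N + 1), wpMat (b ^ 2) (a * b * q) (q ^ 2) (p ^ 2) r n *
        (vwpFac b q p n * wpMat a b q p n k * (a / b) ^ n) := by
      rw [h3, ← mul_assoc, ← mul_assoc, ← mul_pow, show b / a * (a / b) = 1 by field_simp,
        one_pow, one_mul]
    calc _ = wpMat (a * b * q) (b ^ 2) (q ^ 2) (p ^ 2) m r *
        vwpFac (a * b * q) (q ^ 2) (p ^ 2) r * (q ^ r)⁻¹ *
          (ellFac (-a * q) q p (2 * r) / ellFac (-b * q) q p (2 * r) *
            wpMat (a ^ 2) (a * b * q) (q ^ 2) (p ^ 2) r k) := by ring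
      _ = _ := by
        rw [h4, ← mul_assoc, mul_sum]
        refine sum_congr rfl fun n _ => ?_
        rcases lt_or_ge r n with hrn | hrn
        · rw [wpInv, wpMat_of_lt (n := r) (k := n) hrn]
          ring
        · obtain ⟨s, rfl⟩ := Nat.exists_eq_add_of_le hrn
          rw [wpInv, hv, Nat.add_sub_cancel_left, show b ^ 2 / (a * b * q) = b / a / q by field_simp,
            div_pow (b / a), pow_add, pow_add]
          have h5 := hb1 n
          have h6 := hb2 n
          have h7 := hbn'.theta
          generalize ellTheta (-b * q ^ (2 * n)) p = X₁ at *
          have h8 : (b / a) ^ n * (a / b) ^ n = 1 := by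
            rw [← mul_pow, show b / a * (a / b) = 1 by field_simp, one_pow]
          generalize (b / a) ^ n = Y₁ at *
          generalize (a / b) ^ n = Y₂ at *
          field_simp
          linear_combination (wpMat (a * b * q) (b ^ 2) (q ^ 2) (p ^ 2) m (n + s) *
            vwpFac (a * b * q) (q ^ 2) (p ^ 2) (n + s) *
            wpMat (b ^ 2) (a * b * q) (q ^ 2) (p ^ 2) (n + s) n * vwpFac b q p n *
            wpMat a b q p n k) * h8
  rw [sum_congr rfl key, sum_comm]
  simp only [← sum_mul]
  rw [sum_congr rfl fun n _ => by
    rw [sum_wpMat_mul_wpInv h.norm_sq_lt (pow_ne_zero 2 hq) (by positivity) (by positivity) hqn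
      hab hbn2 (by rwa [show a * b * q / b ^ 2 = a * q / b by field_simp]) hN n]]
  simp only [ite_mul, one_mul, zero_mul]
  rw [sum_ite_eq, if_pos (mem_range.mpr (by omega))]

/-- The quadratic summation. -/
lemma sum_wpMat_mul_wpInv_sq (h : QuadGeneric a b q p) {n N : ℕ} (hN : n ≤ N) :
    ∑ k ∈ range (N + 1), wpMat a b q p n k * wpInv (a ^ 2) (a * b * q) (q ^ 2) (p ^ 2) k 0 =
      ellTheta (-b * q ^ (2 * n)) p / ellTheta (-b) p * q ^ n *
        wpMat (a * b * q) (b ^ 2) (q ^ 2) (p ^ 2) n 0 := by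
  have ⟨hp, ha, hb, hq, hqn, han2, hbn2, hab, hba, habq, habq'⟩ := h
  obtain ⟨hbn, hbn'⟩ := hbn2.of_sq hp
  have hb2 : ellTheta (-b * q ^ (2 * n)) p ≠ 0 := by
    rw [← zpow_natCast]; exact hbn' _
  have hb3 := hbn'.theta
  have h1 : ∀ k, wpMat a b q p n k = ellTheta (-b * q ^ (2 * n)) p / ellTheta (-b) p * q ^ n *
      (ellTheta (-b) p / ellTheta (-b * q ^ (2 * n)) p * (q ^ n)⁻¹ * wpMat a b q p n k) :=
    fun k => by
      generalize ellTheta (-b * q ^ (2 * n)) p = X₁ at *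
      field_simp
  simp only [fun k => (h1 k).trans (by rw [← h.sum_connection hN k])]
  simp only [mul_assoc _ _ (wpInv _ _ _ _ _ _), ← mul_sum]
  congr 1
  simp only [sum_mul]
  rw [sum_comm]
  simp only [mul_assoc _ (wpMat (a ^ 2) _ _ _ _ _), ← mul_sum]
  rw [sum_congr rfl fun r hr => by
    rw [sum_wpMat_mul_wpInv h.norm_sq_lt (pow_ne_zero 2 hq) (by positivity) (by positivity) hqn
      han2 hab (by rwa [show a ^ 2 / (a * b * q) = a / (b * q) by field_simp])
      (Nat.lt_succ_iff.mp (mem_range.mp hr)) 0]]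
  simp only [mul_ite, mul_one, mul_zero]
  rw [sum_ite_eq', if_pos (mem_range.mpr (by omega)), vwpFac_zero hab.theta]
  simp

/-- The transformation between the two terminating series, in terms of `wpMat`. -/
lemma sum_transformation (h : QuadGeneric a b q p)
    (h' : QuadGeneric (a ^ 2) (a * b * q) (q ^ 2) (p ^ 2)) (n : ℕ) :
    ∑ r ∈ range (n + 1), wpMat (a * b * q) (b ^ 2) (q ^ 2) (p ^ 2) n r *
        (vwpFac (a * b * q) (q ^ 2) (p ^ 2) r *
          (ellFac (-a * q) q p (2 * r) / ellFac (-b * q) q p (2 * r)) * (q ^ r)⁻¹) *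
        (ellTheta (-(a * b * q) * (q ^ 2) ^ (2 * r)) (p ^ 2) / ellTheta (-(a * b * q)) (p ^ 2) *
          (q ^ 2) ^ r * wpMat (a ^ 2 * (a * b * q) * q ^ 2) ((a * b * q) ^ 2) ((q ^ 2) ^ 2)
            ((p ^ 2) ^ 2) r 0) =
      ellTheta (-b) p / ellTheta (-b * q ^ (2 * n)) p * (q ^ n)⁻¹ *
        ∑ k ∈ range (n + 1), wpMat a b q p n k *
          wpInv ((a ^ 2) ^ 2) (a ^ 2 * (a * b * q) * q ^ 2) ((q ^ 2) ^ 2) ((p ^ 2) ^ 2) k 0 := by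
  rw [sum_congr rfl fun r hr => by
    rw [← h'.sum_wpMat_mul_wpInv_sq (Nat.lt_succ_iff.mp (mem_range.mp hr)), mul_sum], sum_comm,
    mul_sum]
  refine sum_congr rfl fun k _ => ?_
  rw [← mul_assoc _ (wpMat a b q p n k), ← h.sum_connection le_rfl k, sum_mul]
  exact sum_congr rfl fun r _ => by ring

end QuadGeneric

/-! ### Generic parameters -/

/-- The absolute values of `a`, `b`, `q` are multiplicatively independent modulo the powers
of `‖p‖`. -/
def MulIndep (a b q p : ℂ) : Prop :=
  ∀ i j l m : ℤ, ‖a‖ ^ i * ‖b‖ ^ j * ‖q‖ ^ l = ‖p‖ ^ m → i = 0 ∧ j = 0 ∧ l = 0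

lemma ellTheta_ne_zero_of_norm {p a : ℂ} (hp : ‖p‖ < 1) (ha : a ≠ 0)
    (h : ∀ m : ℤ, ‖a‖ ≠ ‖p‖ ^ m) : ellTheta a p ≠ 0 := by
  refine ellTheta_ne_zero hp ha fun m => ⟨by simpa using h m, fun h1 => ?_⟩
  by_cases hm : ‖p‖ ^ m = 0
  · simp [hm] at h1
  · exact h (-m) (by rw [zpow_neg, zpow_natCast]; exact eq_inv_of_mul_eq_one_left h1)

namespace MulIndep

variable {a b q p : ℂ}

lemma theta_ne_zero (h : MulIndep a b q p) (hp : ‖p‖ < 1) (ha : a ≠ 0) (hb : b ≠ 0) (hq : q ≠ 0)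
    {e : ℕ} (he : e ≠ 0) {i j l : ℤ} (hijl : ¬(i = 0 ∧ j = 0 ∧ l = 0)) :
    ellTheta (a ^ i * b ^ j * q ^ l) (p ^ e) ≠ 0 := by
  refine ellTheta_ne_zero_of_norm ?_ (by positivity) fun m hm => hijl (h i j l (e * m) ?_)
  · rw [norm_pow]
    exact pow_lt_one₀ (norm_nonneg _) hp he
  · rw [zpow_mul, zpow_natCast, ← norm_pow, ← hm]
    simp only [norm_mul, norm_zpow]

lemma nonVan (h : MulIndep a b q p) (hp : ‖p‖ < 1) (ha : a ≠ 0) (hb : b ≠ 0) (hq : q ≠ 0)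
    {e : ℕ} (he : e ≠ 0) {x : ℂ} (i j l : ℤ) (hx : x = a ^ i * b ^ j * q ^ l)
    (hij : i ≠ 0 ∨ j ≠ 0) : NonVan x (q ^ e) (p ^ e) := fun k => by
  rw [hx, mul_assoc, ← zpow_natCast q e, ← zpow_mul, ← zpow_add₀ hq]
  exact h.theta_ne_zero hp ha hb hq he (by tauto)

lemma base_ne_zero (h : MulIndep a b q p) (hp : ‖p‖ < 1) (ha : a ≠ 0) (hb : b ≠ 0) (hq : q ≠ 0)
    {e : ℕ} (he : e ≠ 0) (k : ℕ) : ellTheta (q ^ e * (q ^ e) ^ k) (p ^ e) ≠ 0 := by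
  have := h.theta_ne_zero hp ha hb hq he (i := 0) (j := 0) (l := (e * (k + 1) : ℕ))
    (by simp; omega)
  rwa [zpow_zero, zpow_zero, one_mul, one_mul, zpow_natCast, pow_mul, pow_succ'] at this

lemma quadGeneric (h : MulIndep a b q p) (hp : ‖p‖ < 1) (ha : a ≠ 0) (hb : b ≠ 0) (hq : q ≠ 0) :
    QuadGeneric a b q p where
  norm_lt := hp
  a_ne := ha
  b_ne := hb
  q_ne := hq
  base := h.base_ne_zero hp ha hb hq two_ne_zero
  a_sq := h.nonVan hp ha hb hq two_ne_zero 2 0 0 (by simp) (by simp)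
  b_sq := h.nonVan hp ha hb hq two_ne_zero 0 2 0 (by simp) (by simp)
  a_mul_b := h.nonVan hp ha hb hq two_ne_zero 1 1 1 (by simp) (by simp)
  b_div_a := h.nonVan hp ha hb hq two_ne_zero (-1) 1 (-1) (by simp; field_simp) (by simp)
  mul_q_div_b := h.nonVan hp ha hb hq two_ne_zero 1 (-1) 1 (by simp; field_simp) (by simp)
  a_div_b := h.nonVan hp ha hb hq two_ne_zero 1 (-1) (-1) (by simp; field_simp) (by simp)

lemma quadGeneric_sq (h : MulIndep a b q p) (hp : ‖p‖ < 1) (ha : a ≠ 0) (hb : b ≠ 0) (hq : q ≠ 0) :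
    QuadGeneric (a ^ 2) (a * b * q) (q ^ 2) (p ^ 2) := by
  have h4 : ∀ {x : ℂ} (i j l : ℤ), x = a ^ i * b ^ j * q ^ l → (i ≠ 0 ∨ j ≠ 0) →
      NonVan x ((q ^ 2) ^ 2) ((p ^ 2) ^ 2) := fun {x} i j l hx hij => by
    rw [← pow_mul, ← pow_mul]
    exact h.nonVan hp ha hb hq four_ne_zero i j l hx hij
  refine ⟨?_, by positivity, by positivity, by positivity, fun k => ?_, h4 4 0 0 ?_ (by simp),
    h4 2 2 2 ?_ (by simp), h4 3 1 3 ?_ (by simp), h4 (-1) 1 (-1) ?_ (by simp),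
    h4 1 (-1) 1 ?_ (by simp), h4 1 (-1) (-3) ?_ (by simp)⟩
  · rw [norm_pow]
    exact pow_lt_one₀ (norm_nonneg _) hp two_ne_zero
  · rw [← pow_mul q, ← pow_mul p]
    exact h.base_ne_zero hp ha hb hq four_ne_zero k
  all_goals
    simp only [zpow_neg, zpow_ofNat]
    field_simp

end MulIndep

lemma countable_zpow_mem {S : Set ℝ} (hS : S.Countable) :
    {x : ℝ | 0 < x ∧ ∃ i : ℤ, i ≠ 0 ∧ x ^ i ∈ S}.Countable := by
  have h : {x : ℝ | 0 < x ∧ ∃ i : ℤ, i ≠ 0 ∧ x ^ i ∈ S} ⊆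
      ⋃ i : ℤ, {x : ℝ | 0 < x ∧ i ≠ 0 ∧ x ^ i ∈ S} := fun x ⟨h0, i, hi, hx⟩ =>
    Set.mem_iUnion.mpr ⟨i, h0, hi, hx⟩
  refine (Set.countable_iUnion fun i => ?_).mono h
  by_cases hi : i = 0
  · simp [hi]
  · refine Set.MapsTo.countable_of_injOn (f := fun x : ℝ => x ^ i) (t := S)
      (fun x hx => hx.2.2) (fun x hx y hy hxy => ?_) hS
    exact zpow_left_injOn₀ hi hx.1.le hy.1.le hxy

/-- A nonzero `z` can be rescaled by a real factor near `1` so that no nonzero power of the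
absolute value lies in a given countable set. -/
lemma exists_mem_nhds_norm_zpow_notMem {z : ℂ} (hz : z ≠ 0) {S : Set ℝ} (hS : S.Countable) {U : Set ℂ}
    (hU : U ∈ 𝓝 z) : ∃ w ∈ U, w ≠ 0 ∧ ∀ i : ℤ, i ≠ 0 → ‖w‖ ^ i ∉ S := by
  have hc : Tendsto (fun t : ℝ => (t : ℂ) * z) (𝓝 1) (𝓝 z) := by
    have : ContinuousAt (fun t : ℝ => (t : ℂ) * z) 1 := by fun_prop
    simpa [ContinuousAt] using this
  have hV : (fun t : ℝ => (t : ℂ) * z) ⁻¹' U ∩ Set.Ioi 0 ∈ 𝓝 (1 : ℝ) :=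
    inter_mem (hc hU) (Ioi_mem_nhds one_pos)
  have hB : {t : ℝ | 0 < t * ‖z‖ ∧ ∃ i : ℤ, i ≠ 0 ∧ (t * ‖z‖) ^ i ∈ S}.Countable :=
    (countable_zpow_mem hS).preimage (mul_left_injective₀ (norm_ne_zero_iff.mpr hz))
  obtain ⟨t, htB, htU, ht0⟩ := (hB.dense_compl ℝ).inter_nhds_nonempty hV
  have ht0' : 0 < t := ht0
  have hn : ‖(t : ℂ) * z‖ = t * ‖z‖ := by
    rw [norm_mul, Complex.norm_real, Real.norm_of_nonneg ht0'.le]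
  refine ⟨t * z, htU, mul_ne_zero (by exact_mod_cast ht0'.ne') hz, fun i hi hmem => htB ?_⟩
  rw [hn] at hmem
  exact ⟨mul_pos ht0' (norm_pos_iff.mpr hz), i, hi, hmem⟩

/-- Multiplicatively independent parameters are dense: `q`, `b` and `a` are chosen in turn, each
one outside a countable set of absolute values. -/
lemma frequently_mulIndep {a b q : ℂ} (ha : a ≠ 0) (hb : b ≠ 0) (hq : q ≠ 0) (p : ℂ) :
    ∃ᶠ z : ℂ × ℂ × ℂ in 𝓝 (a, b, q),
      (z.1 ≠ 0 ∧ z.2.1 ≠ 0 ∧ z.2.2 ≠ 0) ∧ MulIndep z.1 z.2.1 z.2.2 p := by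
  rw [frequently_iff]
  intro W hW
  obtain ⟨U, hU, V', hV', hUV⟩ := mem_nhds_prod_iff.mp hW
  obtain ⟨V, hV, T, hT, hVT⟩ := mem_nhds_prod_iff.mp hV'
  obtain ⟨q', hqT, hq0, hq'⟩ := exists_mem_nhds_norm_zpow_notMem hq
    (Set.countable_range fun m : ℤ => ‖p‖ ^ m) hT
  obtain ⟨b', hbV, hb0, hb'⟩ := exists_mem_nhds_norm_zpow_notMem hb
    (Set.countable_range fun m : ℤ × ℤ => ‖p‖ ^ m.1 / ‖q'‖ ^ m.2) hV
  obtain ⟨a', haU, ha0, ha'⟩ := exists_mem_nhds_norm_zpow_notMem ha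
    (Set.countable_range fun m : ℤ × ℤ × ℤ => ‖p‖ ^ m.1 / (‖b'‖ ^ m.2.1 * ‖q'‖ ^ m.2.2)) hU
  have nq := norm_pos_iff.mpr hq0
  have nb := norm_pos_iff.mpr hb0
  refine ⟨(a', b', q'), hUV ⟨haU, hVT ⟨hbV, hqT⟩⟩, ⟨ha0, hb0, hq0⟩, fun i j l m h => ?_⟩
  have hi : i = 0 := by
    by_contra hi
    refine ha' i hi ⟨(m, j, l), ?_⟩
    dsimp only at h ⊢
    rw [← h]
    field_simp
  have hj : j = 0 := by
    by_contra hj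
    refine hb' j hj ⟨(m, l), ?_⟩
    dsimp only at h ⊢
    rw [← h, hi]
    field_simp
  refine ⟨hi, hj, ?_⟩
  by_contra hl
  refine hq' l hl ⟨m, ?_⟩
  dsimp only at h ⊢
  rw [← h, hi, hj]
  simp

/-! ### Rewriting the matrix identity as a transformation of series -/

/-- Row `n` of the matrix relative to its first entry, as the coefficient of a terminating
series. -/
lemma wpMat_eq_mul {A K q p : ℂ} (hp : ‖p‖ < 1) (hq : q ≠ 0) (hA : A ≠ 0) (hK : K ≠ 0)
    (hqn : ∀ k : ℕ, ellTheta (q * q ^ k) p ≠ 0) (hKA : NonVan (A / K) q p) {n k : ℕ} (hk : k ≤ n) :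
    wpMat A K q p n k = wpMat A K q p n 0 *
      (ellFac (K * q ^ n) q p k * ellFac (q ^ n)⁻¹ q p k /
        (ellFac (A * q / (K * q ^ n)) q p k * ellFac (A * q * q ^ n) q p k)) *
      (A * q / K) ^ k := by
  have h := ellFac_div_ellFac (p := p) (x := K / A) (x' := q) (z := K) (z' := A * q) hp hq
    (by positivity) hq hk
    (by
      have := (hKA.shift hq (1 - n)).fac k
      rwa [zpow_sub₀ hq, zpow_one, zpow_natCast,
        show A / K * (q / q ^ n) = q / (K / A * q ^ n) by field_simp] at this)
    (ellFac_ne_zero hqn n)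
  rw [wpMat, wpMat, if_pos hk, if_pos (Nat.zero_le n), Nat.sub_zero, Nat.add_zero, h,
    show q / (q * q ^ n) = (q ^ n)⁻¹ by field_simp,
    show q / (K / A * q ^ n) = A * q / (K * q ^ n) by field_simp,
    show q / (K / A) = A * q / K by field_simp]

/-- The term with index `j` of the series with base `q ^ 2`. -/
noncomputable def leftTerm (n : ℕ) (p a b q : ℂ) (j : ℕ) : ℂ :=
  (ellTheta (a ^ 2 * b ^ 2 * q ^ (8 * j + 2)) (p ^ 4)
      * (ellFac (b ^ 2 * q ^ (2 * n)) (q ^ 2) (p ^ 2) j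
        * ellFac (q ^ (-2 * (n : ℤ))) (q ^ 2) (p ^ 2) j)
      * (ellFac (a ^ 2 * b ^ 2 * q ^ 2) (q ^ 4) (p ^ 4) j
        * ellFac (b / (a * q)) (q ^ 4) (p ^ 4) j)
      * ellFac (-a * q) q p (2 * j))
    / (ellTheta (a ^ 2 * b ^ 2 * q ^ 2) (p ^ 4)
      * (ellFac (a * q ^ (3 - 2 * (n : ℤ)) / b) (q ^ 2) (p ^ 2) j
        * ellFac (a * b * q ^ (3 + 2 * n)) (q ^ 2) (p ^ 2) j)
      * (ellFac (q ^ 4) (q ^ 4) (p ^ 4) j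
        * ellFac (a ^ 3 * b * q ^ 7) (q ^ 4) (p ^ 4) j)
      * ellFac (-b * q) q p (2 * j))
    * (a * q ^ 4 / b) ^ j

/-- The term with index `k` of the series with base `q`. -/
noncomputable def rightTerm (n : ℕ) (p a b q : ℂ) (k : ℕ) : ℂ :=
  (ellTheta (a ^ 4 * q ^ (8 * k)) (p ^ 4)
      * (ellFac (b * q ^ n) q p k * ellFac (q ^ (-(n : ℤ))) q p k)
      * (ellFac (a ^ 4) (q ^ 4) (p ^ 4) k
        * ellFac (a / (b * q ^ 3)) (q ^ 4) (p ^ 4) k))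
    / (ellTheta (a ^ 4) (p ^ 4)
      * (ellFac (a * q ^ (1 - (n : ℤ)) / b) q p k * ellFac (a * q ^ (1 + n)) q p k)
      * (ellFac (q ^ 4) (q ^ 4) (p ^ 4) k
        * ellFac (a ^ 3 * b * q ^ 7) (q ^ 4) (p ^ 4) k))
    * q ^ (4 * k)

/-- The factor between the two series. -/
noncomputable def prefactor (n : ℕ) (p a b q : ℂ) : ℂ :=
  (ellTheta (-b) p
      * (ellFac (-q) q p n * ellFac (b / a) q p n)
      * ellFac (a * b * q ^ 3) (q ^ 2) (p ^ 2) n)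
    / (ellTheta (-b * q ^ (2 * n)) p
      * (ellFac (-b) q p n * ellFac (a * q) q p n)
      * ellFac (b / (a * q)) (q ^ 2) (p ^ 2) n)
    * q ^ (-(n : ℤ))

/-- The summand on the left of `QuadGeneric.sum_transformation`, relative to the one of
index `0`. -/
lemma wpMat_mul_eq_leftTerm {n : ℕ} {a b q p : ℂ} (h : QuadGeneric a b q p)
    {j : ℕ} (hj : j ≤ n) :
    wpMat (a * b * q) (b ^ 2) (q ^ 2) (p ^ 2) n j *
        (vwpFac (a * b * q) (q ^ 2) (p ^ 2) j *
          (ellFac (-a * q) q p (2 * j) / ellFac (-b * q) q p (2 * j)) * (q ^ j)⁻¹) *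
        (ellTheta (-(a * b * q) * (q ^ 2) ^ (2 * j)) (p ^ 2) / ellTheta (-(a * b * q)) (p ^ 2) *
          (q ^ 2) ^ j * wpMat (a ^ 2 * (a * b * q) * q ^ 2) ((a * b * q) ^ 2) ((q ^ 2) ^ 2)
            ((p ^ 2) ^ 2) j 0) =
      wpMat (a * b * q) (b ^ 2) (q ^ 2) (p ^ 2) n 0 * leftTerm n p a b q j := by
  have ⟨hp, ha, hb, hq, hqn, han2, hbn2, hab, hba, habq, habq'⟩ := h
  rw [wpMat_eq_mul (k := j) h.norm_sq_lt (pow_ne_zero 2 hq) (by positivity) (by positivity) hqn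
    (by rwa [show a * b * q / b ^ 2 = a * q / b by field_simp]) hj, leftTerm,
    wpMat.eq_1 _ _ _ _ j 0, if_pos (Nat.zero_le j), Nat.sub_zero, Nat.add_zero, vwpFac]
  have t1 : ellTheta (a ^ 2 * b ^ 2 * q ^ (8 * j + 2)) (p ^ 4) =
      ellTheta (a * b * q * (q ^ 2) ^ (2 * j)) (p ^ 2) *
        ellTheta (-(a * b * q) * (q ^ 2) ^ (2 * j)) (p ^ 2) := by
    rw [neg_mul, ← ellTheta_sq h.norm_sq_lt]
    congr 1 <;> ring
  have t2 : ellTheta (a ^ 2 * b ^ 2 * q ^ 2) (p ^ 4) =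
      ellTheta (a * b * q) (p ^ 2) * ellTheta (-(a * b * q)) (p ^ 2) := by
    rw [← ellTheta_sq h.norm_sq_lt]
    congr 1 <;> ring
  have z1 : (q : ℂ) ^ (-2 * (n : ℤ)) = ((q ^ 2) ^ n)⁻¹ := by
    rw [neg_mul, zpow_neg, ← pow_mul]
    norm_cast
  have z2 : a * q ^ (3 - 2 * (n : ℤ)) / b = a * b * q * q ^ 2 / (b ^ 2 * (q ^ 2) ^ n) := by
    rw [sub_eq_add_neg, zpow_add₀ hq, ← neg_mul, z1, zpow_ofNat]
    field_simp
  rw [t1, t2, z1, z2, show (q ^ 2) ^ 2 = q ^ 4 by ring, show (p ^ 2) ^ 2 = p ^ 4 by ring,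
    show (a * b * q) ^ 2 / (a ^ 2 * (a * b * q) * q ^ 2) = b / (a * q) by field_simp,
    show (a * b * q) ^ 2 = a ^ 2 * b ^ 2 * q ^ 2 by ring,
    show a ^ 2 * (a * b * q) * q ^ 2 * q ^ 4 = a ^ 3 * b * q ^ 7 by ring,
    show a * b * q * q ^ 2 * (q ^ 2) ^ n = a * b * q ^ (3 + 2 * n) by ring,
    show b ^ 2 * (q ^ 2) ^ n = b ^ 2 * q ^ (2 * n) by ring,
    show a * b * q * q ^ 2 / b ^ 2 = a * q ^ 4 / b / q by field_simp, div_pow (a * q ^ 4 / b),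
    show ((q : ℂ) ^ 2) ^ j = q ^ j * q ^ j by ring]
  have hqj := pow_ne_zero j hq
  have e : (a * q ^ 4 / b) ^ j = (a * q ^ 4 / b) ^ j / q ^ j * (q ^ j)⁻¹ * (q ^ j * q ^ j) := by
    field_simp
  conv_rhs => rw [e]
  ring

/-- The summand on the right of `QuadGeneric.sum_transformation`, relative to the one of
index `0`. -/
lemma wpMat_mul_eq_rightTerm {n : ℕ} {a b q p : ℂ} (h : QuadGeneric a b q p)
    (h' : QuadGeneric (a ^ 2) (a * b * q) (q ^ 2) (p ^ 2)) (hab1 : NonVan (a / b) q p) {k : ℕ}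
    (hk : k ≤ n) :
    wpMat a b q p n k *
        wpInv ((a ^ 2) ^ 2) (a ^ 2 * (a * b * q) * q ^ 2) ((q ^ 2) ^ 2) ((p ^ 2) ^ 2) k 0 =
      wpMat a b q p n 0 * rightTerm n p a b q k := by
  have ⟨hp, ha, hb, hq, hqn, han2, hbn2, hab, hba, habq, habq'⟩ := h
  have hq1 := fun k => (ellTheta_ne_zero_of_sq hp hqn k).1
  have h0 := h'.a_mul_b
  rw [wpMat_eq_mul (k := k) hp hq ha hb hq1 hab1 hk, rightTerm, wpInv, wpMat.eq_1 _ _ _ _ k 0,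
    if_pos (Nat.zero_le k), Nat.sub_zero, Nat.add_zero, vwpFac_zero h0.theta, vwpFac]
  have z1 : (q : ℂ) ^ (-(n : ℤ)) = (q ^ n)⁻¹ := by rw [zpow_neg, zpow_natCast]
  have z2 : a * q ^ (1 - (n : ℤ)) / b = a * q / (b * q ^ n) := by
    rw [zpow_sub₀ hq, zpow_one, zpow_natCast]
    field_simp
  rw [z1, z2, show (q ^ 2) ^ 2 = q ^ 4 by ring, show (p ^ 2) ^ 2 = p ^ 4 by ring,
    show (a ^ 2) ^ 2 = a ^ 4 by ring,
    show a ^ 4 / (a ^ 2 * (a * b * q) * q ^ 2) = a / (b * q ^ 3) by field_simp,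
    show a ^ 2 * (a * b * q) * q ^ 2 * q ^ 4 = a ^ 3 * b * q ^ 7 by ring,
    show a * q * q ^ n = a * q ^ (1 + n) by ring,
    show a ^ 4 * (q ^ 4) ^ (2 * k) = a ^ 4 * q ^ (8 * k) by ring,
    show a ^ 2 * (a * b * q) * q ^ 2 / a ^ 4 = b * q ^ 3 / a by field_simp]
  have e : q ^ (4 * k) = (a * q / b) ^ k * (b * q ^ 3 / a) ^ k := by
    rw [← mul_pow, pow_mul]
    congr 1
    field_simp
  rw [e]
  ring

/-- The transformation of series, for parameters in general position. -/
lemma sum_leftTerm_eq_of_mulIndep {a b q p : ℂ} (n : ℕ) (hp : ‖p‖ < 1) (ha : a ≠ 0) (hb : b ≠ 0)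
    (hq : q ≠ 0) (h : MulIndep a b q p) :
    ∑ j ∈ range (n + 1), leftTerm n p a b q j =
      prefactor n p a b q * ∑ k ∈ range (n + 1), rightTerm n p a b q k := by
  have hg := h.quadGeneric hp ha hb hq
  have hg' := h.quadGeneric_sq hp ha hb hq
  have hq2 : q ^ 2 ≠ 0 := pow_ne_zero 2 hq
  have hab1 : NonVan (a / b) q p := by
    have := h.nonVan hp ha hb hq one_ne_zero (x := a / b) 1 (-1) 0 (by simp; field_simp) (by simp)
    rwa [pow_one, pow_one] at this
  have key := hg.sum_transformation hg' n
  rw [sum_congr rfl fun j hj =>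
      wpMat_mul_eq_leftTerm hg (Nat.lt_succ_iff.mp (mem_range.mp hj)), ← mul_sum,
    sum_congr rfl fun k hk =>
      wpMat_mul_eq_rightTerm hg hg' hab1 (Nat.lt_succ_iff.mp (mem_range.mp hk)), ← mul_sum] at key
  obtain ⟨hbn, hbn'⟩ := hg.b_sq.of_sq hp
  obtain ⟨han, han'⟩ := hg.a_sq.of_sq hp
  have e1 : b ^ 2 / (a * b * q) = b / (a * q) := by field_simp
  have f1 := hg.b_div_a.fac n
  have f2 := hg.b_sq.fac n
  have f3 := ellFac_ne_zero hg.base n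
  have f4 : ellFac (a * b * q * q ^ 2) (q ^ 2) (p ^ 2) n ≠ 0 := by
    simpa using (hg.a_mul_b.shift hq2 1).fac n
  have f5 : ellFac (a * q) q p n ≠ 0 := by simpa using (han.shift hq 1).fac n
  have hM : wpMat (a * b * q) (b ^ 2) (q ^ 2) (p ^ 2) n 0 ≠ 0 := by
    rw [wpMat, if_pos (Nat.zero_le n), Nat.sub_zero, Nat.add_zero, e1]
    exact div_ne_zero (mul_ne_zero f1 f2) (mul_ne_zero f3 f4)
  refine mul_left_cancel₀ hM (key.trans ?_)
  rw [← mul_assoc, ← mul_assoc]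
  congr 1
  rw [ellFac_sq hp] at f2 f3
  rw [wpMat, wpMat, if_pos (Nat.zero_le n), if_pos (Nat.zero_le n), Nat.sub_zero, Nat.add_zero, e1,
    prefactor, ellFac_sq hp, ellFac_sq hp, show a * b * q ^ 3 = a * b * q * q ^ 2 by ring,
    zpow_neg, zpow_natCast]
  have g1 := left_ne_zero_of_mul f2
  have g2 := right_ne_zero_of_mul f2
  have g3 := left_ne_zero_of_mul f3
  have g4 := right_ne_zero_of_mul f3
  have g5 : ellTheta (-b * q ^ (2 * n)) p ≠ 0 := by rw [← zpow_natCast]; exact hbn' _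
  clear key hM f2 f3
  generalize ellTheta (-b * q ^ (2 * n)) p = X₁ at *
  generalize ellFac (a * b * q * q ^ 2) (q ^ 2) (p ^ 2) n = X₂ at *
  generalize ellFac (b / (a * q)) (q ^ 2) (p ^ 2) n = X₃ at *
  generalize ellFac (a * q) q p n = X₄ at *
  generalize ellFac (b / a) q p n = X₅ at *
  generalize ellFac (-b) q p n = X₆ at *
  field_simp

/-! ### Removal of the genericity assumption by continuity -/

lemma ellFac_ne_zero_of_le {x q p : ℂ} {k n : ℕ} (h : ellFac x q p n ≠ 0) (hk : k ≤ n) :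
    ellFac x q p k ≠ 0 := by
  obtain ⟨m, rfl⟩ := Nat.exists_eq_add_of_le hk
  rw [ellFac_add] at h
  exact left_ne_zero_of_mul h

/-- The function `f` is continuous and nonzero at `x`. Theta functions are continuous away from the
origin only, and the arguments at which they occur here are, up to sign, monomials in the
parameters with integer exponents, for which this condition is inherited from the parameters. -/
structure ContNeAt {X : Type*} [TopologicalSpace X] (f : X → ℂ) (x : X) : Prop where
  cont : ContinuousAt f x
  ne_zero : f x ≠ 0

namespace ContNeAt

variable {X : Type*} [TopologicalSpace X] {f g : X → ℂ} {x : X} {p : ℂ}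

lemma mul (hf : ContNeAt f x) (hg : ContNeAt g x) : ContNeAt (fun z => f z * g z) x :=
  ⟨Tendsto.mul hf.cont hg.cont, mul_ne_zero hf.ne_zero hg.ne_zero⟩

lemma div (hf : ContNeAt f x) (hg : ContNeAt g x) : ContNeAt (fun z => f z / g z) x :=
  ⟨Tendsto.div hf.cont hg.cont hg.ne_zero, div_ne_zero hf.ne_zero hg.ne_zero⟩

lemma neg (hf : ContNeAt f x) : ContNeAt (fun z => -f z) x :=
  ⟨Tendsto.neg hf.cont, neg_ne_zero.mpr hf.ne_zero⟩

lemma pow (hf : ContNeAt f x) (m : ℕ) : ContNeAt (fun z => f z ^ m) x :=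
  ⟨Tendsto.pow hf.cont m, pow_ne_zero m hf.ne_zero⟩

lemma zpow (hf : ContNeAt f x) (m : ℤ) : ContNeAt (fun z => f z ^ m) x :=
  ⟨Tendsto.zpow₀ hf.cont m (Or.inl hf.ne_zero), zpow_ne_zero m hf.ne_zero⟩

lemma ellTheta (hf : ContNeAt f x) (hp : ‖p‖ < 1) :
    ContinuousAt (fun z => _root_.ellTheta (f z) p) x :=
  Tendsto.comp (continuousAt_ellTheta hp hf.ne_zero) hf.cont

lemma ellFac (hf : ContNeAt f x) (hg : ContNeAt g x) (hp : ‖p‖ < 1) (k : ℕ) :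
    ContinuousAt (fun z => _root_.ellFac (f z) (g z) p k) x :=
  tendsto_finsetProd _ fun j _ => (hf.mul (hg.pow j)).ellTheta hp

end ContNeAt

section

variable {n : ℕ} {a b q p : ℂ}

lemma contNeAt_fst (ha : a ≠ 0) : ContNeAt (fun z : ℂ × ℂ × ℂ => z.1) (a, b, q) :=
  ⟨by fun_prop, ha⟩

lemma contNeAt_snd_fst (hb : b ≠ 0) : ContNeAt (fun z : ℂ × ℂ × ℂ => z.2.1) (a, b, q) :=
  ⟨by fun_prop, hb⟩

lemma contNeAt_snd_snd (hq : q ≠ 0) : ContNeAt (fun z : ℂ × ℂ × ℂ => z.2.2) (a, b, q) :=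
  ⟨by fun_prop, hq⟩

lemma continuousAt_leftTerm (hp : ‖p‖ < 1) (ha : a ≠ 0) (hb : b ≠ 0) (hq : q ≠ 0)
    (hL₁ : ellTheta (a ^ 2 * b ^ 2 * q ^ 2) (p ^ 4) ≠ 0)
    (hL₂ : ellFac (a * q ^ (3 - 2 * (n : ℤ)) / b) (q ^ 2) (p ^ 2) n ≠ 0)
    (hL₃ : ellFac (a * b * q ^ (3 + 2 * n)) (q ^ 2) (p ^ 2) n ≠ 0)
    (hL₄ : ellFac (q ^ 4) (q ^ 4) (p ^ 4) n ≠ 0)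
    (hL₅ : ellFac (a ^ 3 * b * q ^ 7) (q ^ 4) (p ^ 4) n ≠ 0)
    (hL₆ : ellFac (-b * q) q p (2 * n) ≠ 0) {j : ℕ} (hj : j ≤ n) :
    ContinuousAt (fun z : ℂ × ℂ × ℂ => leftTerm n p z.1 z.2.1 z.2.2 j) (a, b, q) := by
  have hp2 : ‖p ^ 2‖ < 1 := by rw [norm_pow]; exact pow_lt_one₀ (norm_nonneg _) hp two_ne_zero
  have hp4 : ‖p ^ 4‖ < 1 := by rw [norm_pow]; exact pow_lt_one₀ (norm_nonneg _) hp four_ne_zero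
  have A := contNeAt_fst (b := b) (q := q) ha
  have B := contNeAt_snd_fst (a := a) (q := q) hb
  have Q := contNeAt_snd_snd (a := a) (b := b) hq
  have num := (((((A.pow 2).mul (B.pow 2)).mul (Q.pow (8 * j + 2))).ellTheta hp4).fun_mul
      ((((B.pow 2).mul (Q.pow (2 * n))).ellFac (Q.pow 2) hp2 j).fun_mul
        ((Q.zpow (-2 * (n : ℤ))).ellFac (Q.pow 2) hp2 j))).fun_mul
      (((((A.pow 2).mul (B.pow 2)).mul (Q.pow 2)).ellFac (Q.pow 4) hp4 j).fun_mul
        ((B.div (A.mul Q)).ellFac (Q.pow 4) hp4 j)) |>.fun_mul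
      ((A.neg.mul Q).ellFac Q hp (2 * j))
  have den := (((((A.pow 2).mul (B.pow 2)).mul (Q.pow 2)).ellTheta hp4).fun_mul
      ((((A.mul (Q.zpow (3 - 2 * (n : ℤ)))).div B).ellFac (Q.pow 2) hp2 j).fun_mul
        (((A.mul B).mul (Q.pow (3 + 2 * n))).ellFac (Q.pow 2) hp2 j))).fun_mul
      (((Q.pow 4).ellFac (Q.pow 4) hp4 j).fun_mul
        ((((A.pow 3).mul B).mul (Q.pow 7)).ellFac (Q.pow 4) hp4 j)) |>.fun_mul
      ((B.neg.mul Q).ellFac Q hp (2 * j))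
  exact (ContinuousAt.div num den (mul_ne_zero (mul_ne_zero (mul_ne_zero hL₁
      (mul_ne_zero (ellFac_ne_zero_of_le hL₂ hj) (ellFac_ne_zero_of_le hL₃ hj)))
      (mul_ne_zero (ellFac_ne_zero_of_le hL₄ hj) (ellFac_ne_zero_of_le hL₅ hj)))
      (ellFac_ne_zero_of_le hL₆ (by omega)))).fun_mul (((A.mul (Q.pow 4)).div B).pow j).cont

lemma continuousAt_rightTerm (hp : ‖p‖ < 1) (ha : a ≠ 0) (hb : b ≠ 0) (hq : q ≠ 0)
    (hR₅ : ellTheta (a ^ 4) (p ^ 4) ≠ 0)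
    (hR₆ : ellFac (a * q ^ (1 - (n : ℤ)) / b) q p n ≠ 0)
    (hR₇ : ellFac (a * q ^ (1 + n)) q p n ≠ 0)
    (hL₄ : ellFac (q ^ 4) (q ^ 4) (p ^ 4) n ≠ 0)
    (hL₅ : ellFac (a ^ 3 * b * q ^ 7) (q ^ 4) (p ^ 4) n ≠ 0) {k : ℕ} (hk : k ≤ n) :
    ContinuousAt (fun z : ℂ × ℂ × ℂ => rightTerm n p z.1 z.2.1 z.2.2 k) (a, b, q) := by
  have hp4 : ‖p ^ 4‖ < 1 := by rw [norm_pow]; exact pow_lt_one₀ (norm_nonneg _) hp four_ne_zero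
  have A := contNeAt_fst (b := b) (q := q) ha
  have B := contNeAt_snd_fst (a := a) (q := q) hb
  have Q := contNeAt_snd_snd (a := a) (b := b) hq
  have num := ((((A.pow 4).mul (Q.pow (8 * k))).ellTheta hp4).fun_mul
      (((B.mul (Q.pow n)).ellFac Q hp k).fun_mul ((Q.zpow (-(n : ℤ))).ellFac Q hp k))).fun_mul
      (((A.pow 4).ellFac (Q.pow 4) hp4 k).fun_mul
        ((A.div (B.mul (Q.pow 3))).ellFac (Q.pow 4) hp4 k))
  have den := (((A.pow 4).ellTheta hp4).fun_mul
      ((((A.mul (Q.zpow (1 - (n : ℤ)))).div B).ellFac Q hp k).fun_mul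
        ((A.mul (Q.pow (1 + n))).ellFac Q hp k))).fun_mul
      (((Q.pow 4).ellFac (Q.pow 4) hp4 k).fun_mul
        ((((A.pow 3).mul B).mul (Q.pow 7)).ellFac (Q.pow 4) hp4 k))
  exact (ContinuousAt.div num den (mul_ne_zero (mul_ne_zero hR₅
      (mul_ne_zero (ellFac_ne_zero_of_le hR₆ hk) (ellFac_ne_zero_of_le hR₇ hk)))
      (mul_ne_zero (ellFac_ne_zero_of_le hL₄ hk) (ellFac_ne_zero_of_le hL₅ hk)))).fun_mul
    (Q.pow (4 * k)).cont

lemma continuousAt_prefactor (hp : ‖p‖ < 1) (ha : a ≠ 0) (hb : b ≠ 0) (hq : q ≠ 0)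
    (hR₁ : ellTheta (-b * q ^ (2 * n)) p ≠ 0) (hR₂ : ellFac (-b) q p n ≠ 0)
    (hR₃ : ellFac (a * q) q p n ≠ 0)
    (hR₄ : ellFac (b / (a * q)) (q ^ 2) (p ^ 2) n ≠ 0) :
    ContinuousAt (fun z : ℂ × ℂ × ℂ => prefactor n p z.1 z.2.1 z.2.2) (a, b, q) := by
  have hp2 : ‖p ^ 2‖ < 1 := by rw [norm_pow]; exact pow_lt_one₀ (norm_nonneg _) hp two_ne_zero
  have A := contNeAt_fst (b := b) (q := q) ha
  have B := contNeAt_snd_fst (a := a) (q := q) hb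
  have Q := contNeAt_snd_snd (a := a) (b := b) hq
  have num := ((B.neg.ellTheta hp).fun_mul
      ((Q.neg.ellFac Q hp n).fun_mul ((B.div A).ellFac Q hp n))).fun_mul
      (((A.mul B).mul (Q.pow 3)).ellFac (Q.pow 2) hp2 n)
  have den := (((B.neg.mul (Q.pow (2 * n))).ellTheta hp).fun_mul
      ((B.neg.ellFac Q hp n).fun_mul ((A.mul Q).ellFac Q hp n))).fun_mul
      ((B.div (A.mul Q)).ellFac (Q.pow 2) hp2 n)
  exact (ContinuousAt.div num den (mul_ne_zero (mul_ne_zero hR₁ (mul_ne_zero hR₂ hR₃)) hR₄)).fun_mul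
    (Q.zpow (-(n : ℤ))).cont

end

theorem mainTheorem5 (n : ℕ) (a b q p : ℂ)
    (ha : a ≠ 0) (hb : b ≠ 0) (hq : q ≠ 0) (hp : ‖p‖ < 1)
    -- the denominators of the sum on the left do not vanish
    (hL₁ : ellTheta (a ^ 2 * b ^ 2 * q ^ 2) (p ^ 4) ≠ 0)
    (hL₂ : ellFac (a * q ^ (3 - 2 * (n : ℤ)) / b) (q ^ 2) (p ^ 2) n ≠ 0)
    (hL₃ : ellFac (a * b * q ^ (3 + 2 * n)) (q ^ 2) (p ^ 2) n ≠ 0)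
    (hL₄ : ellFac (q ^ 4) (q ^ 4) (p ^ 4) n ≠ 0)
    (hL₅ : ellFac (a ^ 3 * b * q ^ 7) (q ^ 4) (p ^ 4) n ≠ 0)
    (hL₆ : ellFac (-b * q) q p (2 * n) ≠ 0)
    -- the denominators of the prefactor on the right do not vanish
    (hR₁ : ellTheta (-b * q ^ (2 * n)) p ≠ 0)
    (hR₂ : ellFac (-b) q p n ≠ 0)
    (hR₃ : ellFac (a * q) q p n ≠ 0)
    (hR₄ : ellFac (b / (a * q)) (q ^ 2) (p ^ 2) n ≠ 0)
    -- the remaining denominators of the sum on the right do not vanish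
    (hR₅ : ellTheta (a ^ 4) (p ^ 4) ≠ 0)
    (hR₆ : ellFac (a * q ^ (1 - (n : ℤ)) / b) q p n ≠ 0)
    (hR₇ : ellFac (a * q ^ (1 + n)) q p n ≠ 0) :
    (∑ j ∈ Finset.range (n + 1),
      (ellTheta (a ^ 2 * b ^ 2 * q ^ (8 * j + 2)) (p ^ 4)
          * (ellFac (b ^ 2 * q ^ (2 * n)) (q ^ 2) (p ^ 2) j
            * ellFac (q ^ (-2 * (n : ℤ))) (q ^ 2) (p ^ 2) j)
          * (ellFac (a ^ 2 * b ^ 2 * q ^ 2) (q ^ 4) (p ^ 4) j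
            * ellFac (b / (a * q)) (q ^ 4) (p ^ 4) j)
          * ellFac (-a * q) q p (2 * j))
        / (ellTheta (a ^ 2 * b ^ 2 * q ^ 2) (p ^ 4)
          * (ellFac (a * q ^ (3 - 2 * (n : ℤ)) / b) (q ^ 2) (p ^ 2) j
            * ellFac (a * b * q ^ (3 + 2 * n)) (q ^ 2) (p ^ 2) j)
          * (ellFac (q ^ 4) (q ^ 4) (p ^ 4) j
            * ellFac (a ^ 3 * b * q ^ 7) (q ^ 4) (p ^ 4) j)
          * ellFac (-b * q) q p (2 * j))
        * (a * q ^ 4 / b) ^ j)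
    = (ellTheta (-b) p
          * (ellFac (-q) q p n * ellFac (b / a) q p n)
          * ellFac (a * b * q ^ 3) (q ^ 2) (p ^ 2) n)
        / (ellTheta (-b * q ^ (2 * n)) p
          * (ellFac (-b) q p n * ellFac (a * q) q p n)
          * ellFac (b / (a * q)) (q ^ 2) (p ^ 2) n)
        * q ^ (-(n : ℤ))
      * ∑ k ∈ Finset.range (n + 1),
        (ellTheta (a ^ 4 * q ^ (8 * k)) (p ^ 4)
            * (ellFac (b * q ^ n) q p k * ellFac (q ^ (-(n : ℤ))) q p k)
            * (ellFac (a ^ 4) (q ^ 4) (p ^ 4) k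
              * ellFac (a / (b * q ^ 3)) (q ^ 4) (p ^ 4) k))
          / (ellTheta (a ^ 4) (p ^ 4)
            * (ellFac (a * q ^ (1 - (n : ℤ)) / b) q p k * ellFac (a * q ^ (1 + n)) q p k)
            * (ellFac (q ^ 4) (q ^ 4) (p ^ 4) k
              * ellFac (a ^ 3 * b * q ^ 7) (q ^ 4) (p ^ 4) k))
          * q ^ (4 * k) := by
  -- Both sides are continuous at `(a, b, q)`, since no denominator vanishes there, and they agree
  -- at generic parameters arbitrarily close by.
  change ∑ j ∈ range (n + 1), leftTerm n p a b q j =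
    prefactor n p a b q * ∑ k ∈ range (n + 1), rightTerm n p a b q k
  have hL : ContinuousAt (fun z : ℂ × ℂ × ℂ =>
      ∑ j ∈ range (n + 1), leftTerm n p z.1 z.2.1 z.2.2 j) (a, b, q) :=
    tendsto_finsetSum _ fun j hj => continuousAt_leftTerm hp ha hb hq hL₁ hL₂ hL₃ hL₄ hL₅ hL₆
      (Nat.lt_succ_iff.mp (mem_range.mp hj))
  have hR : ContinuousAt (fun z : ℂ × ℂ × ℂ => prefactor n p z.1 z.2.1 z.2.2 *
      ∑ k ∈ range (n + 1), rightTerm n p z.1 z.2.1 z.2.2 k) (a, b, q) :=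
    (continuousAt_prefactor hp ha hb hq hR₁ hR₂ hR₃ hR₄).mul <|
      tendsto_finsetSum _ fun k hk => continuousAt_rightTerm hp ha hb hq hR₅ hR₆ hR₇ hL₄ hL₅
        (Nat.lt_succ_iff.mp (mem_range.mp hk))
  exact tendsto_nhds_unique_of_frequently_eq hL hR
    ((frequently_mulIndep ha hb hq p).mono fun z hz =>
      sum_leftTerm_eq_of_mulIndep n hp hz.1.1 hz.1.2.1 hz.1.2.2 hz.2)
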